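/- A lattice $L$ is an SPS lattice if it is finite and planar (it has a planar Hasse diagram with straight line segments as edges), semimodular, and slim (it has no sublattice isomorphic to $M_3$). A covering square of $L$ is a set $S=\{o,a_l,a_r,i\}$ with $o\prec a_l\prec i$, $o\prec a_r\prec i$, $a_l\neq a_r$; it is tight if $i$ covers exactly two elements, $a_l$ and $a_r$, in $L$. Inserting a fork at $S$ yields the lattice $L[S]$: put $x_{l,1}=a_l$, $y_{l,1}=o$, and, as long as there is a covering square $\{y_{l,k+1},x_{l,k+1},y_{l,k},x_{l,k}\}$ of $L$ with top $x_{l,k}$, bottom $y_{l,k+1}$ and sides $x_{l,k+1}\ne y_{l,k}$, continue with $x_{l,k+1},y_{l,k+1}$; define $x_{r,k},y_{r,k}$ symmetrically, starting with $x_{r,1}=a_r$, $y_{r,1}=o$. The elements of $L[S]$ are those of $L$, a new element $t$, and new elements $z_{l,1},\dots,z_{l,n},z_{r,1},\dots,z_{r,m}$, one for each pair $(x_{l,k},y_{l,k})$ and $(x_{r,k},y_{r,k})$; its order is generated by the order of $L$ and the relations $z_{l,1}<t$, $z_{r,1}<t$, $t<i$, $y_{s,k}<z_{s,k}<x_{s,k}$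 and $z_{s,k+1}<z_{s,k}$ ($s\in\{l,r\}$). For a congruence $\alpha$ of $L$, its minimal extension $\overline{\alpha}$ is the smallest congruence of $L[S]$ that contains $\alpha$. Let $\gamma(S)=\mathrm{con}_{L[S]}(t,i)$ be the smallest congruence of $L[S]$ with $t\equiv i$. A congruence is join-irreducible if it is join-irreducible (in particular, not the least element) in the congruence lattice. **Theorem.** Let $L$ be an SPS lattice and let $S$ be a tight square of $L$. Then $L[S]$ is a lattice that contains $L$ as a sublattice, and it has exactly one join-irreducible congruence that is not the minimal extension $\overline{\alpha}$ of a join-irreducible congruence $\alpha$ of $L$, namely, $\gamma(S)$. -/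

import Mathlib

/-! ## Slim, planar, semimodular lattices -/

/-- A poset is planar if it is finite and has a planar Hasse diagram: the elements are represented
by distinct points of the plane, larger elements are placed higher, every covering pair `a ⋖ b` is
represented by the straight line segment from `a` to `b`, and two different such segments meet at
most in a point that represents a common endpoint. -/
def IsPlanarPoset (L : Type*) [PartialOrder L] : Prop :=
  Finite L ∧ ∃ φ : L → ℝ × ℝ, Function.Injective φ ∧
    (∀ a b : L, a < b → (φ a).2 < (φ b).2) ∧
    ∀ a b c d : L, a ⋖ b → c ⋖ d → (a, b) ≠ (c, d) →
      ∀ P : ℝ × ℝ, P ∈ segment ℝ (φ a) (φ b) → P ∈ segment ℝ (φ c) (φ d) →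
        ∃ e : L, (e = a ∨ e = b) ∧ (e = c ∨ e = d) ∧ P = φ e

/-- A lattice is slim if it has no sublattice isomorphic to `M₃`, i.e., no three distinct elements
that pairwise have the same join and pairwise have the same meet. -/
def IsSlimLattice (L : Type*) [Lattice L] : Prop :=
  ¬ ∃ a b c : L, a ≠ b ∧ b ≠ c ∧ a ≠ c ∧
    a ⊓ b = b ⊓ c ∧ b ⊓ c = a ⊓ c ∧ a ⊔ b = b ⊔ c ∧ b ⊔ c = a ⊔ c

/-- SPS lattices: slim, planar (hence finite), semimodular lattices. -/
structure IsSPS (L : Type*) [Lattice L] : Prop where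
  slim : IsSlimLattice L
  planar : IsPlanarPoset L
  semimodular : IsUpperModularLattice L

/-! ## Covering squares and the fork extension -/

/-- `{o, a, b, i}` is a covering square with bottom `o`, top `i` and sides `a ≠ b`. -/
def IsCoveringSquare {L : Type*} [Lattice L] (o a b i : L) : Prop :=
  a ≠ b ∧ o ⋖ a ∧ o ⋖ b ∧ a ⋖ i ∧ b ⋖ i

/-- In a covering square, the bottom is the meet and the top is the join of the two sides. -/
theorem IsCoveringSquare.inf_eq_and_sup_eq {L : Type*} [Lattice L] {o a b i : L}
    (h : IsCoveringSquare o a b i) : a ⊓ b = o ∧ a ⊔ b = i := by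
  obtain ⟨hab, hoa, hob, hai, hbi⟩ := h
  have hnle : ¬ b ≤ a := fun hle =>
    (hoa.eq_or_eq hob.le hle).elim (fun h => hob.ne h.symm) (fun h => hab h.symm)
  constructor
  · refine (hob.eq_or_eq (le_inf hoa.le hob.le) inf_le_right).resolve_right ?_
    exact fun h => hnle (inf_eq_right.mp h)
  · refine (hai.eq_or_eq le_sup_left (sup_le hai.le hbi.le)).resolve_left ?_
    exact fun h => hnle (sup_eq_left.mp h)

/-- A covering square `{o, al, ar, i}` of a lattice. -/
structure CoveringSquare (L : Type*) [Lattice L] where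
  o : L
  al : L
  ar : L
  i : L
  isCoveringSquare : IsCoveringSquare o al ar i

/-- The two sides of a square. -/
inductive Side : Type
  | left
  | right

namespace CoveringSquare

variable {L : Type*} [Lattice L]

/-- The square `S` is tight if its top covers exactly two elements, `al` and `ar`. -/
def IsTight (S : CoveringSquare L) : Prop :=
  ∀ c : L, c ⋖ S.i ↔ c = S.al ∨ c = S.ar

/-- The side element `al` or `ar`. -/
def side (S : CoveringSquare L) : Side → L
  | Side.left => S.al
  | Side.right => S.ar

/-- `S.Leg s x y` says that `(x, y)` is one of the pairs `(x_{s,k}, y_{s,k})`, `k ≥ 1`, of the fork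
construction on the side `s`: the first pair is `(a_s, o)`, and `(x_{s,k+1}, y_{s,k+1})` is obtained
from `(x_{s,k}, y_{s,k})` by a covering square with bottom `y_{s,k+1}`, sides `x_{s,k+1}` and
`y_{s,k}`, and top `x_{s,k}`. -/
inductive Leg (S : CoveringSquare L) (s : Side) : L → L → Prop
  | base : Leg S s (S.side s) S.o
  | step {x y x' y' : L} : Leg S s x y → IsCoveringSquare y' x' y x → Leg S s x' y'

/-- The underlying set of `L[S]`: the elements of `L`, the element `t`, and a new element
`z_{s,k}` for every pair `(x_{s,k}, y_{s,k})` on either side `s`. -/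
inductive Fork (S : CoveringSquare L) : Type _
  | old (a : L) : Fork S
  | t : Fork S
  | z (s : Side) (x y : L) (h : S.Leg s x y) : Fork S

/-- The relations that generate the order of `L[S]`: those of `L`, `z_{s,1} < t < i`,
`y_{s,k} < z_{s,k} < x_{s,k}`, and `z_{s,k+1} < z_{s,k}`. -/
inductive ForkStep (S : CoveringSquare L) : S.Fork → S.Fork → Prop
  | old {a b : L} : a ≤ b → ForkStep S (Fork.old a) (Fork.old b)
  | t_i : ForkStep S Fork.t (Fork.old S.i)
  | z_t (s : Side) : ForkStep S (Fork.z s (S.side s) S.o Leg.base) Fork.t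
  | y_z (s : Side) {x y : L} (h : S.Leg s x y) : ForkStep S (Fork.old y) (Fork.z s x y h)
  | z_x (s : Side) {x y : L} (h : S.Leg s x y) : ForkStep S (Fork.z s x y h) (Fork.old x)
  | z_z (s : Side) {x y x' y' : L} (h : S.Leg s x y) (hsq : IsCoveringSquare y' x' y x) :
      ForkStep S (Fork.z s x' y' (Leg.step h hsq)) (Fork.z s x y h)

/-- The order of `L[S]`: the reflexive transitive closure of the generating relations. -/
def ForkLE (S : CoveringSquare L) : S.Fork → S.Fork → Prop :=
  Relation.ReflTransGen S.ForkStep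

end CoveringSquare

/-! ## Congruences of lattices -/

namespace LatticeCon

/-- Congruences are ordered by inclusion: `θ ≤ ψ` iff `x ≡ y (θ)` implies `x ≡ y (ψ)`. -/
instance instPartialOrder {K : Type*} [Lattice K] : PartialOrder (LatticeCon K) :=
  PartialOrder.lift LatticeCon.toSetoid (fun c d h => by cases c; cases d; cases h; rfl)

/-- The infimum of a set of congruences is their intersection. -/
instance instInfSet {K : Type*} [Lattice K] : InfSet (LatticeCon K) where
  sInf C :=
    { toSetoid := sInf (LatticeCon.toSetoid '' C)
      inf := by
        rintro w x y z h₁ h₂ _ ⟨c, hc, rfl⟩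
        exact c.inf (h₁ _ ⟨c, hc, rfl⟩) (h₂ _ ⟨c, hc, rfl⟩)
      sup := by
        rintro w x y z h₁ h₂ _ ⟨c, hc, rfl⟩
        exact c.sup (h₁ _ ⟨c, hc, rfl⟩) (h₂ _ ⟨c, hc, rfl⟩) }

/-- The congruence lattice of a lattice. -/
instance instCompleteLattice {K : Type*} [Lattice K] : CompleteLattice (LatticeCon K) :=
  completeLatticeOfInf (LatticeCon K) (fun _ =>
    ⟨fun c hc _ _ h => h c.toSetoid ⟨c, hc, rfl⟩,
      fun _ hd _ _ h _ ⟨_, hc, e⟩ => e ▸ hd hc h⟩)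

/-- The smallest congruence that contains the relation `R`. -/
def gen {K : Type*} [Lattice K] (R : K → K → Prop) : LatticeCon K :=
  sInf {c | ∀ a b : K, R a b → c.r a b}

/-- The principal congruence `con(a, b)`. -/
def principal {K : Type*} [Lattice K] (a b : K) : LatticeCon K :=
  gen (fun x y => x = a ∧ y = b)

end LatticeCon

namespace CoveringSquare

/-- The minimal extension of a congruence `α` of `L` to `L[S]`: the smallest congruence of `L[S]`
that contains `α`. -/
def minimalExtension {L : Type*} [Lattice L] (S : CoveringSquare L) [Lattice S.Fork]
    (α : LatticeCon L) : LatticeCon S.Fork :=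
  LatticeCon.gen (fun p q => ∃ a b : L, α.r a b ∧ p = Fork.old a ∧ q = Fork.old b)

/-- The congruence `γ(S) = con(t, i)` of `L[S]`. -/
def gamma {L : Type*} [Lattice L] (S : CoveringSquare L) [Lattice S.Fork] : LatticeCon S.Fork :=
  LatticeCon.principal Fork.t (Fork.old S.i)

end CoveringSquare

/-! ## Conjugate orders and slim semimodular lattices -/

/-! Planarity is used only through the left-of relation on incomparable elements, whose transitivity
comes from the intermediate value theorem applied to paths in the diagram. Together with
semimodularity and slimness it gives every element at most two upper covers. It also makes each leg
of the fork a chain in which `y` is the extreme lower cover of `x` on the inner side.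

The extension becomes tractable in coordinates: an element of `L[S]` is sent to its shadow, the
least element of `L` above it, and to the bit `IsHigh`. This is an order embedding into the product
of `L` with a two-element chain (`forkLE_iff`). The low elements have as shadows exactly `lowSet`:
the ideal of `o`, the legs, and `i`. This set is closed under joins, so joins are coordinatewise. If
one factor of a meet is low, the shadow of the meet is the largest element of `lowSet` below the
meet of the shadows (`exists_approx`). It is found by walking down a leg, and tightness is what puts
every element strictly below `i` under one of the two sides.

A join-irreducible congruence of a finite lattice is generated by a prime interval. Each prime
interval of `L[S]` generates the same congruence as `[t, i]` or as a prime interval of `L`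
(`principal_eq_gamma_or`), so only `γ(S)` can be new.

To see that it is new, note that the shadow map need not preserve meets, but does so modulo the
congruence `lowCon` of `L`, which ignores the meet-irreducible elements whose cover lies strictly
below `i`. Its pullback `shadowCon` identifies `t` with `i`. If `γ(S)` were the minimal extension of
`α`, then `α` would lie in `lowCon`, which never identifies an element below `o` with one that is
not (`le_o_of_lowEquiv`). Hence the extension would lie in `levelCon`, which preserves the bit
`IsHigh`, whereas `t` and `i` differ in that bit. -/

/-- `lam` is a conjugate order ("left of") of a partial order: a transitive relation such that two
elements are related by `lam` in some direction if and only if they are incomparable. -/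
structure IsConjugateOrder {L : Type*} [PartialOrder L] (lam : L → L → Prop) : Prop where
  trans : ∀ {a b c : L}, lam a b → lam b c → lam a c
  not_le : ∀ {a b : L}, lam a b → ¬ a ≤ b
  not_ge : ∀ {a b : L}, lam a b → ¬ b ≤ a
  total : ∀ {a b : L}, ¬ a ≤ b → ¬ b ≤ a → lam a b ∨ lam b a

namespace IsConjugateOrder

variable {L : Type*} [PartialOrder L] {lam : L → L → Prop}

theorem swap (h : IsConjugateOrder lam) : IsConjugateOrder (fun a b => lam b a) where
  trans hab hbc := h.trans hbc hab
  not_le hab := h.not_ge hab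
  not_ge hab := h.not_le hab
  total hab hba := (h.total hab hba).symm

/-- If `s` were incomparable to `b`, it would lie on one side of `b`, hence by transitivity be
incomparable to `a` or to `c`. -/
theorem le_of_between (h : IsConjugateOrder lam) {a b c s : L} (hab : lam a b) (hbc : lam b c)
    (has : a ≤ s) (hcs : c ≤ s) : b ≤ s := by
  by_contra hbs
  by_cases hsb : s ≤ b
  · exact h.not_le hab (has.trans hsb)
  · rcases h.total hbs hsb with h1 | h1
    · exact h.not_le (h.trans hab h1) has
    · exact h.not_ge (h.trans h1 hbc) hcs

theorem ge_of_between (h : IsConjugateOrder lam) {a b c d : L} (hab : lam a b) (hbc : lam b c)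
    (had : d ≤ a) (hcd : d ≤ c) : d ≤ b := by
  by_contra hdb
  by_cases hbd : b ≤ d
  · exact h.not_ge hab (hbd.trans had)
  · rcases h.total hdb hbd with h1 | h1
    · exact h.not_le (h.trans h1 hbc) hcd
    · exact h.not_ge (h.trans hab h1) had

/-- An element between two others that is above an element of each of their ideals. -/
theorem le_of_spanning (h : IsConjugateOrder lam) {p z q e f w : L} (hpz : lam p z) (hp : p ≤ q)
    (hz : z ≤ q) (hep : e ≤ p) (hez : ¬ e ≤ z) (hfz : f ≤ z) (hfp : ¬ f ≤ p) (hew : e ≤ w)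
    (hfw : f ≤ w) (hpw : ¬ p ≤ w) (hzw : ¬ z ≤ w) : w ≤ q := by
  have hpf : lam p f := by
    rcases h.total (fun hpf => h.not_le hpz (hpf.trans hfz)) hfp with h1 | h1
    · exact h1
    · exact absurd hfz (h.not_le (h.trans h1 hpz))
  have hez' : lam e z := by
    rcases h.total hez (fun hze => h.not_ge hpz (hze.trans hep)) with h1 | h1
    · exact h1
    · exact absurd hep (h.not_ge (h.trans hpz h1))
  have h1 : lam p w := by
    rcases h.total hpw (fun hwp => hfp (hfw.trans hwp)) with h1 | h1
    · exact h1
    · exact absurd hfw (h.not_ge (h.trans h1 hpf))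
  have h2 : lam w z := by
    rcases h.total hzw (fun hwz => hez (hew.trans hwz)) with h2 | h2
    · exact absurd hew (h.not_le (h.trans hez' h2))
    · exact h2
  exact h.le_of_between h1 h2 hp hz

end IsConjugateOrder

/-- A slim semimodular lattice with a conjugate order: the combinatorial content of an SPS
lattice. -/
structure IsOrientedSPS {L : Type*} [Lattice L] (lam : L → L → Prop) : Prop where
  slim : IsSlimLattice L
  finite : Finite L
  semimodular : IsUpperModularLattice L
  conj : IsConjugateOrder lam

namespace IsOrientedSPS

variable {L : Type*} [Lattice L] {lam : L → L → Prop}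

theorem swap (h : IsOrientedSPS lam) : IsOrientedSPS (fun a b => lam b a) :=
  ⟨h.slim, h.finite, h.semimodular, h.conj.swap⟩

theorem covBy_sup (h : IsOrientedSPS lam) {a b : L} (hab : a ⊓ b ⋖ a) : b ⋖ a ⊔ b :=
  h.semimodular.covBy_sup_of_inf_covBy hab

theorem inf_eq_of_covBy {p a b : L} (ha : p ⋖ a) (hb : p ⋖ b) (hab : a ≠ b) : a ⊓ b = p := by
  refine ((ha.eq_or_eq (le_inf ha.le hb.le) inf_le_left).resolve_right ?_)
  intro h1
  rcases hb.eq_or_eq ha.le (inf_eq_left.mp h1) with h2 | h2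
  · exact ha.ne h2.symm
  · exact hab h2

theorem sup_eq_of_covBy {q a b : L} (ha : a ⋖ q) (hb : b ⋖ q) (hab : a ≠ b) : a ⊔ b = q := by
  refine ((ha.eq_or_eq le_sup_left (sup_le ha.le hb.le)).resolve_left ?_)
  intro h1
  rcases hb.eq_or_eq (sup_eq_left.mp h1) ha.le with h2 | h2
  · exact hab h2
  · exact ha.ne h2

theorem not_le_of_covBy {q a b : L} (ha : a ⋖ q) (hb : b ⋖ q) (hab : a ≠ b) : ¬ a ≤ b := by
  intro h
  rcases ha.eq_or_eq h hb.le with h2 | h2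
  · exact hab h2.symm
  · exact hb.ne h2

theorem not_le_of_covBy' {p a b : L} (ha : p ⋖ a) (hb : p ⋖ b) (hab : a ≠ b) : ¬ a ≤ b := by
  intro h
  rcases hb.eq_or_eq ha.le h with h2 | h2
  · exact ha.ne h2.symm
  · exact hab h2

/-- By betweenness the middle cover lies below the join of the outer two. By semimodularity that
join covers both outer elements, so all pairwise joins coincide and the three covers span an `M₃`.
-/
theorem not_three_covers_of_between (h : IsOrientedSPS lam) {p a b c : L} (ha : p ⋖ a) (hb : p ⋖ b)
    (hc : p ⋖ c) (hab : lam a b) (hbc : lam b c) : False := by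
  have nab : a ≠ b := fun e => h.conj.not_le hab e.le
  have nbc : b ≠ c := fun e => h.conj.not_le hbc e.le
  have nac : a ≠ c := fun e => h.conj.not_le (h.conj.trans hab hbc) e.le
  have iab := inf_eq_of_covBy ha hb nab
  have ibc := inf_eq_of_covBy hb hc nbc
  have iac := inf_eq_of_covBy ha hc nac
  have hb' : b ≤ a ⊔ c := h.conj.le_of_between hab hbc le_sup_left le_sup_right
  have h1 : c ⋖ a ⊔ c := h.covBy_sup (by rw [iac]; exact ha)
  have h2 : a ⋖ a ⊔ c := by
    rw [sup_comm]; exact h.covBy_sup (by rw [inf_comm, iac]; exact hc)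
  have e1 : a ⊔ b = a ⊔ c :=
    (h2.eq_or_eq le_sup_left (sup_le le_sup_left hb')).resolve_left
      fun e => not_le_of_covBy' hb ha nab.symm (sup_eq_left.mp e)
  have e2 : b ⊔ c = a ⊔ c :=
    (h1.eq_or_eq le_sup_right (sup_le hb' le_sup_right)).resolve_left
      fun e => not_le_of_covBy' hb hc nbc (sup_eq_right.mp e)
  exact h.slim ⟨a, b, c, nab, nbc, nac, by rw [iab, ibc], by rw [ibc, iac], by rw [e1, e2], e2⟩

/-- Every element has at most two upper covers. -/
theorem eq_or_eq_of_covBy (h : IsOrientedSPS lam) {p a b c : L} (ha : p ⋖ a) (hb : p ⋖ b)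
    (hc : p ⋖ c) (hab : a ≠ b) : c = a ∨ c = b := by
  by_contra! hne
  have key : ∀ {x y : L}, p ⋖ x → p ⋖ y → x ≠ y → lam x y ∨ lam y x := fun hx hy hxy =>
    h.conj.total (not_le_of_covBy' hx hy hxy) (not_le_of_covBy' hy hx hxy.symm)
  rcases key ha hb hab with h1 | h1 <;> rcases key hc ha hne.1 with h2 | h2 <;>
    rcases key hc hb hne.2 with h3 | h3
  · exact h.not_three_covers_of_between hc ha hb h2 h1
  · exact h.not_three_covers_of_between hc ha hb h2 h1
  · exact h.not_three_covers_of_between ha hc hb h2 h3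
  · exact h.not_three_covers_of_between ha hb hc h1 h3
  · exact h.not_three_covers_of_between hc hb ha h3 h1
  · exact h.not_three_covers_of_between hb hc ha h3 h2
  · exact h.not_three_covers_of_between hb ha hc h1 h2
  · exact h.not_three_covers_of_between hb ha hc h1 h2

/-- If `r ⋖ e`, the elements above `r` and not above `e` are closed under joins. -/
theorem not_le_sup_of_covBy (h : IsOrientedSPS lam) {x y : L} :
    ∀ {r e : L}, r ⋖ e → r ≤ x → r ≤ y → ¬ e ≤ x → ¬ e ≤ y → ¬ e ≤ x ⊔ y := by
  have := h.finite
  intro r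
  induction r using WellFoundedGT.induction with
  | ind r ih =>
    intro e hre hrx hry hex hey hexy
    rcases hrx.eq_or_lt with rfl | hrx
    · exact hey (by rwa [sup_eq_right.mpr hry] at hexy)
    rcases hry.eq_or_lt with rfl | hry
    · exact hex (by rwa [sup_eq_left.mpr hrx.le] at hexy)
    obtain ⟨f, hrf, hfx⟩ := exists_covBy_le_of_lt hrx
    obtain ⟨f', hrf', hfy⟩ := exists_covBy_le_of_lt hry
    have nfe : f ≠ e := fun e' => hex (e' ▸ hfx)
    have nfe' : f' ≠ e := fun e' => hey (e' ▸ hfy)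
    have hff : f' = f := (h.eq_or_eq_of_covBy hrf hre hrf' nfe).resolve_right nfe'
    subst hff
    -- Having only two upper covers forces `x` and `y` above the same cover of `r`; the covering
    -- pair is then pushed up by semimodularity and the induction continues from there.
    have hc : f' ⋖ e ⊔ f' := h.covBy_sup (by rwa [inf_eq_of_covBy hre hrf nfe.symm])
    exact ih f' hrf.lt hc hfx hfy (fun h' => hex (le_sup_left.trans h'))
      (fun h' => hey (le_sup_left.trans h')) (sup_le hexy (hfx.trans le_sup_left))

/-- If `m` has a unique cover `s`, `r ⋖ e`, and `m` is above `r` but not above `e`, then `m` is the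
largest such element. -/
theorem le_of_unique_cover (h : IsOrientedSPS lam) {r e a m s : L} (hre : r ⋖ e) (hra : r ≤ a)
    (hea : ¬ e ≤ a) (hrm : r ≤ m) (hem : ¬ e ≤ m) (hms : m < s) (hs : ∀ w, m < w → s ≤ w) :
    a ≤ m := by
  by_contra ham
  have hme : e ⊓ m = r := (hre.eq_or_eq (le_inf hre.le hrm) inf_le_left).resolve_right
    fun e' => hem (inf_eq_left.mp e')
  have hc : m ⋖ e ⊔ m := h.covBy_sup (by rwa [hme])
  have hse : s = e ⊔ m := (hc.eq_or_eq hms.le (hs _ hc.lt)).resolve_left hms.ne'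
  have h1 : s ≤ a ⊔ m := hs _ (lt_of_le_of_ne le_sup_right fun e' => ham (sup_eq_right.mp e'.symm))
  exact h.not_le_sup_of_covBy hre hra hrm hea hem ((hse ▸ le_sup_left : e ≤ s).trans h1)

/-- A lower cover of `x` between two other lower covers is comparable to `x` only through a unique
cover: everything above it is below or above `x`. -/
theorem le_or_ge_of_middle (h : IsOrientedSPS lam) {x e g y w : L} (he : e ⋖ x) (hg : g ⋖ x)
    (hy : y ⋖ x) (heg : lam e g) (hgy : lam g y) (hgw : g ≤ w) : w ≤ x ∨ x ≤ w := by
  by_cases hew : e ≤ w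
  · right
    rw [← sup_eq_of_covBy he hg fun e' => h.conj.not_le heg e'.le]
    exact sup_le hew hgw
  by_cases hyw : y ≤ w
  · right
    rw [← sup_eq_of_covBy hg hy fun e' => h.conj.not_le hgy e'.le]
    exact sup_le hgw hyw
  left
  have h1 : lam e w := by
    rcases h.conj.total hew (fun hwe => h.conj.not_ge heg (hgw.trans hwe)) with h1 | h1
    · exact h1
    · exact absurd hgw (h.conj.not_ge (h.conj.trans h1 heg))
  have h2 : lam w y := by
    rcases h.conj.total hyw (fun hwy => h.conj.not_le hgy (hgw.trans hwy)) with h2 | h2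
    · exact absurd hgw (h.conj.not_le (h.conj.trans hgy h2))
    · exact h2
  exact h.conj.le_of_between h1 h2 he.le hy.le

/-! ### The congruence determined by the meet-irreducible elements whose cover is not below `i` -/

end IsOrientedSPS

/-- The meet-irreducible elements whose unique cover is not strictly below `i`. -/
def highMeetIrred {L : Type*} [Lattice L] (i : L) : Set L :=
  {m | ∃ s, m < s ∧ (∀ w, m < w → s ≤ w) ∧ ¬ s < i}

/-- Elements not separated by `highMeetIrred i`. -/
def LowEquiv {L : Type*} [Lattice L] (i a b : L) : Prop :=
  ∀ m ∈ highMeetIrred i, a ≤ m ↔ b ≤ m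

namespace IsOrientedSPS

variable {L : Type*} [Lattice L] {lam : L → L → Prop}

theorem exists_unique_cover (h : IsOrientedSPS lam) {a b : L} (hab : ¬ b ≤ a) :
    ∃ m s, a ≤ m ∧ ¬ b ≤ m ∧ m < s ∧ (∀ w, m < w → s ≤ w) ∧ b ≤ s := by
  have := h.finite
  obtain ⟨m, ham, hm⟩ := Finite.exists_le_maximal (p := fun m => a ≤ m ∧ ¬ b ≤ m) ⟨le_rfl, hab⟩
  refine ⟨m, m ⊔ b, hm.prop.1, hm.prop.2,
    lt_of_le_of_ne le_sup_left fun e => hm.prop.2 (sup_eq_left.mp e.symm), ?_, le_sup_right⟩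
  intro w hw
  refine sup_le hw.le ?_
  by_contra hbw
  exact hw.not_ge (hm.le_of_ge ⟨ham.trans hw.le, hbw⟩ hw.le)

/-- A maximal element above `a` and not above `b` is meet-irreducible with cover above `b`. It
separates `a` from `b`, so its cover must be strictly below `i`. -/
theorem lt_of_lowEquiv (h : IsOrientedSPS lam) {i a b : L} (hab : a < b) (he : LowEquiv i a b) :
    b < i := by
  obtain ⟨m, s, ham, hbm, hms, hs, hbs⟩ := h.exists_unique_cover hab.not_ge
  by_contra hbi
  refine hbm ((he m ⟨s, hms, hs, fun hsi => hbi (hbs.trans_lt hsi)⟩).mp ham)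

/-- This is the core of compatibility with meets. A meet-irreducible `m` separating `a ⊓ z` from `z`
must lie above the covers of `a ⊓ z` under `a` and under `z`. It is then squeezed between `a` and
`z`, so it is strictly below `b` and its cover is strictly below `i`; such an `m` does not count. -/
theorem lowEquiv_inf_of_covBy (h : IsOrientedSPS lam) {i a b z : L} (hab : a ⋖ b) (hzb : z ⋖ b)
    (haz : a ≠ z) (he : LowEquiv i a b) : LowEquiv i (a ⊓ z) z := by
  have := h.finite
  intro m hm
  refine ⟨fun hrm => ?_, fun hzm => inf_le_right.trans hzm⟩
  have hbi := h.lt_of_lowEquiv hab.lt he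
  by_contra hzm
  have ham : ¬ a ≤ m := fun ham => hzm (hzb.le.trans ((he m hm).mp ham))
  obtain ⟨s, hms, hs, hsi⟩ := hm
  have naz := not_le_of_covBy hab hzb haz
  have nza := not_le_of_covBy hzb hab haz.symm
  obtain ⟨e, hre, hea⟩ := exists_covBy_le_of_lt
    (lt_of_le_of_ne inf_le_left fun e => naz (inf_eq_left.mp e) : a ⊓ z < a)
  obtain ⟨f, hrf, hfz⟩ := exists_covBy_le_of_lt
    (lt_of_le_of_ne inf_le_right fun e => nza (inf_eq_right.mp e) : a ⊓ z < z)
  have hez : ¬ e ≤ z := fun hez => hre.lt.not_ge (le_inf hea hez)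
  have hfa : ¬ f ≤ a := fun hfa => hrf.lt.not_ge (le_inf hfa hfz)
  have hfm : f ≤ m := by
    by_contra hfm
    exact ham (h.le_of_unique_cover hrf inf_le_left hfa hrm hfm hms hs)
  have hem : e ≤ m := by
    by_contra hem
    exact hzm (h.le_of_unique_cover hre inf_le_right hez hrm hem hms hs)
  have hmb : m ≤ b := by
    rcases h.conj.total naz nza with h1 | h1
    · exact h.conj.le_of_spanning h1 hab.le hzb.le hea hez hfz hfa hem hfm ham hzm
    · exact h.conj.le_of_spanning h1 hzb.le hab.le hfz hfa hea hez hfm hem hzm ham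
  have hmb' : m < b := lt_of_le_of_ne hmb fun e => ham (e ▸ hab.le)
  exact hsi ((hs b hmb').trans_lt hbi)

theorem _root_.LowEquiv.trans {i a b c : L} (h : LowEquiv i a b) (h' : LowEquiv i b c) :
    LowEquiv i a c := fun m hm => (h m hm).trans (h' m hm)

theorem _root_.LowEquiv.symm {i a b : L} (h : LowEquiv i a b) : LowEquiv i b a :=
  fun m hm => (h m hm).symm

/-- The covering case is propagated along chains: outer induction lowers the top `b`, inner
induction raises `a` towards it. -/
theorem lowEquiv_inf_of_le (h : IsOrientedSPS lam) {i : L} :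
    ∀ {b a c : L}, a ≤ b → c ≤ b → LowEquiv i a b → LowEquiv i (a ⊓ c) c := by
  have := h.finite
  intro b
  induction b using WellFoundedLT.induction with
  | ind b ihb =>
  intro a
  induction a using WellFoundedGT.induction with
  | ind a iha =>
  intro c hab hcb he
  rcases hab.eq_or_lt with rfl | hab
  · rw [inf_eq_right.mpr hcb]; exact fun _ _ => Iff.rfl
  obtain ⟨a', haa', ha'b⟩ := exists_covBy_le_of_lt hab
  have he' : LowEquiv i a' b := fun m hm =>
    ⟨fun h' => (he m hm).mp (haa'.le.trans h'), fun h' => ha'b.trans h'⟩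
  rcases ha'b.eq_or_lt with rfl | ha'b
  · rcases hcb.eq_or_lt with rfl | hcb
    · rwa [inf_eq_left.mpr hab.le]
    · obtain ⟨z, hcz, hzb⟩ := exists_le_covBy_of_lt hcb
      by_cases haz : a = z
      · subst haz
        rw [inf_eq_right.mpr hcz]; exact fun _ _ => Iff.rfl
      · have := ihb z hzb.lt inf_le_right hcz (h.lowEquiv_inf_of_covBy haa' hzb haz he)
        rwa [inf_assoc, inf_eq_right.mpr hcz] at this
  · have h1 := iha a' haa'.lt ha'b.le hcb he'
    have h2 := ihb a' ha'b haa'.le (inf_le_left : a' ⊓ c ≤ a') (he.trans he'.symm)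
    rw [← inf_assoc, inf_eq_left.mpr haa'.le] at h2
    exact h2.trans h1

theorem lowEquiv_inf_right (h : IsOrientedSPS lam) {i a b : L} (he : LowEquiv i a b) (c : L) :
    LowEquiv i (a ⊓ c) (b ⊓ c) := by
  have h1 : LowEquiv i a (a ⊔ b) := fun m hm =>
    ⟨fun h' => sup_le h' ((he m hm).mp h'), fun h' => le_sup_left.trans h'⟩
  have h2 := h.lowEquiv_inf_of_le le_sup_left (inf_le_left : (a ⊔ b) ⊓ c ≤ a ⊔ b) h1
  have h3 := h.lowEquiv_inf_of_le le_sup_right (inf_le_left : (a ⊔ b) ⊓ c ≤ a ⊔ b)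
    (he.symm.trans h1)
  rw [← inf_assoc, inf_sup_self] at h2
  rw [← inf_assoc, inf_eq_left.mpr (le_sup_right : b ≤ a ⊔ b)] at h3
  exact h2.trans h3.symm

/-- The congruence that identifies the elements not separated by `highMeetIrred i`. -/
def lowCon (h : IsOrientedSPS lam) (i : L) : LatticeCon L where
  r := LowEquiv i
  iseqv := ⟨fun _ _ _ => Iff.rfl, LowEquiv.symm, LowEquiv.trans⟩
  inf {w x y z} h1 h2 := by
    refine (h.lowEquiv_inf_right h1 y).trans ?_
    rw [inf_comm x, inf_comm x]
    exact h.lowEquiv_inf_right h2 x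
  sup h1 h2 m hm := by rw [sup_le_iff, sup_le_iff, h1 m hm, h2 m hm]

/-- Everything above the middle lower cover `g` is comparable to `x`. A meet-irreducible above `g`
but not above `x` is therefore strictly below `x`, and its cover is at most `x < i`. -/
theorem lowEquiv_of_middle (h : IsOrientedSPS lam) {i x e g y : L} (he : e ⋖ x) (hg : g ⋖ x)
    (hy : y ⋖ x) (heg : lam e g) (hgy : lam g y) (hxi : x < i) : LowEquiv i g x := by
  rintro m ⟨s, hms, hs, hsi⟩
  refine ⟨fun hgm => ?_, fun hxm => hg.le.trans hxm⟩
  rcases h.le_or_ge_of_middle he hg hy heg hgy hgm with h1 | h1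
  · rcases h1.eq_or_lt with h2 | h2
    · exact h2.ge
    · exact absurd ((hs x h2).trans_lt hxi) hsi
  · exact h1

end IsOrientedSPS

/-! ## The legs of a fork -/

/-- The opposite side. -/
def Side.opp : Side → Side
  | Side.left => Side.right
  | Side.right => Side.left

theorem Side.eq_or_eq_opp (s s' : Side) : s' = s ∨ s' = s.opp := by
  cases s <;> cases s' <;> simp [Side.opp]

namespace CoveringSquare

variable {L : Type*} [Lattice L] {S : CoveringSquare L} {s : Side} {x y : L}

theorem isCoveringSquare_side (S : CoveringSquare L) (s : Side) :
    IsCoveringSquare S.o (S.side s) (S.side s.opp) S.i := by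
  obtain ⟨h1, h2, h3, h4, h5⟩ := S.isCoveringSquare
  cases s
  · exact ⟨h1, h2, h3, h4, h5⟩
  · exact ⟨h1.symm, h3, h2, h5, h4⟩

theorem side_sup_side (S : CoveringSquare L) (s : Side) : S.side s ⊔ S.side s.opp = S.i :=
  (S.isCoveringSquare_side s).inf_eq_and_sup_eq.2

theorem side_inf_side (S : CoveringSquare L) (s : Side) : S.side s ⊓ S.side s.opp = S.o :=
  (S.isCoveringSquare_side s).inf_eq_and_sup_eq.1

theorem o_lt_i (S : CoveringSquare L) : S.o < S.i :=
  (S.isCoveringSquare_side Side.left).2.1.lt.trans (S.isCoveringSquare_side Side.left).2.2.2.1.lt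

namespace Leg

theorem covBy (h : S.Leg s x y) : y ⋖ x := by
  cases h with
  | base => exact (S.isCoveringSquare_side s).2.1
  | step h hsq => exact hsq.2.1

theorem inf_o (h : S.Leg s x y) : x ⊓ S.o = y := by
  induction h with
  | base => exact inf_eq_right.mpr (S.isCoveringSquare_side s).2.1.le
  | step h hsq ih =>
    rw [← hsq.inf_eq_and_sup_eq.1, ← ih, ← inf_assoc, inf_eq_left.mpr hsq.2.2.2.1.le]

theorem le_o (h : S.Leg s x y) : y ≤ S.o := h.inf_o ▸ inf_le_right

theorem not_le_o (h : S.Leg s x y) : ¬ x ≤ S.o := fun hx =>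
  h.covBy.ne (h.inf_o.symm.trans (inf_eq_left.mpr hx))

theorem le_side (h : S.Leg s x y) : x ≤ S.side s := by
  induction h with
  | base => exact le_rfl
  | step h hsq ih => exact hsq.2.2.2.1.le.trans ih

theorem lt_i (h : S.Leg s x y) : x < S.i :=
  h.le_side.trans_lt (S.isCoveringSquare_side s).2.2.2.1.lt

theorem sup_o (h : S.Leg s x y) : x ⊔ S.o = S.side s := by
  refine ((S.isCoveringSquare_side s).2.1.eq_or_eq le_sup_right
    (sup_le h.le_side (S.isCoveringSquare_side s).2.1.le)).resolve_left ?_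
  exact fun e => h.not_le_o (sup_eq_right.mp e)

theorem not_le_opp (h : S.Leg s x y) {x' y' : L} (h' : S.Leg s.opp x' y') : ¬ x ≤ x' := fun hle =>
  h.not_le_o (S.side_inf_side s ▸ le_inf h.le_side (hle.trans h'.le_side))

end Leg

end CoveringSquare

/-! ### Structure of the legs: uniqueness, continuation, joins -/

namespace IsOrientedSPS

open CoveringSquare

variable {L : Type*} [Lattice L] {lam : L → L → Prop} {S : CoveringSquare L} {s : Side} {x y : L}

theorem exists_orientation (h : IsOrientedSPS lam) (S : CoveringSquare L) (s : Side) :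
    ∃ lam' : L → L → Prop, IsOrientedSPS lam' ∧ lam' (S.side s) (S.side s.opp) := by
  obtain ⟨hne, h1, h2, -, -⟩ := S.isCoveringSquare_side s
  rcases h.conj.total (not_le_of_covBy' h1 h2 hne) (not_le_of_covBy' h2 h1 hne.symm) with h3 | h3
  · exact ⟨lam, h, h3⟩
  · exact ⟨_, h.swap, h3⟩

/-- A lower cover `c` of `x` other than `y` is not below `w`, so it lies to the left of `w`. Were it
to the right of `y`, then `y` would be to the left of `w`, contrary to `y ≤ w`. -/
theorem lam_of_square (h : IsOrientedSPS lam) {w v c : L} (hsq : IsCoveringSquare y x w v)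
    (hxw : lam x w) (hc : c ⋖ x) (hcy : c ≠ y) : lam c y := by
  have hyx := hsq.2.1
  refine (h.conj.total (not_le_of_covBy hc hyx hcy) (not_le_of_covBy hyx hc hcy.symm)).resolve_right
    fun hyc => ?_
  have hcw : lam c w := by
    refine (h.conj.total (fun hcw => ?_) fun hwc => h.conj.not_ge hxw (hwc.trans hc.le)).resolve_right
      fun hwc => ?_
    · exact not_le_of_covBy hc hyx hcy (hsq.inf_eq_and_sup_eq.1 ▸ le_inf hc.le hcw)
    · exact h.conj.not_ge (h.conj.trans hxw hwc) hc.le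
  exact h.conj.not_le (h.conj.trans hyc hcw) hsq.2.2.1.le

/-- On the side `s` of the square that is on the left, the element `y` is the rightmost lower cover
of `x` for every pair `(x, y)` of the leg. -/
theorem lam_of_leg (h : IsOrientedSPS lam) (hs : lam (S.side s) (S.side s.opp)) (hl : S.Leg s x y) :
    ∀ {c : L}, c ⋖ x → c ≠ y → lam c y := by
  induction hl with
  | base => exact fun hc hcy => h.lam_of_square (S.isCoveringSquare_side s) hs hc hcy
  | step hl hsq ih =>
    exact fun hc hcy => h.lam_of_square hsq (ih hsq.2.2.2.1 hsq.1) hc hcy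

/-- Betweenness gives `y₂ ≤ x₁`, so the two squares share their bottom, which then has three covers.
-/
theorem not_lam_of_squares (h : IsOrientedSPS lam) {x₁ y₁ x₂ y₂ : L} (h₁ : IsCoveringSquare y₁ x₁ y x)
    (h₂ : IsCoveringSquare y₂ x₂ y x) (hxy : lam x₁ y) (hxx : lam x₂ x₁) : False := by
  have h3 : y₂ ≤ y₁ := by
    rw [← h₁.inf_eq_and_sup_eq.1]
    exact le_inf (h.conj.ge_of_between hxx hxy h₂.2.1.le h₂.2.2.1.le) h₂.2.2.1.le
  have h4 : y₂ = y₁ :=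
    ((h₂.2.2.1.eq_or_eq h3 h₁.2.2.1.le).resolve_right h₁.2.2.1.ne).symm
  subst h4
  exact h.not_three_covers_of_between h₂.2.1 h₁.2.1 h₁.2.2.1 hxx hxy

/-- A leg has at most one continuation at each of its pairs. -/
theorem square_unique (h : IsOrientedSPS lam) (hl : S.Leg s x y) {x₁ y₁ x₂ y₂ : L}
    (h₁ : IsCoveringSquare y₁ x₁ y x) (h₂ : IsCoveringSquare y₂ x₂ y x) : x₁ = x₂ ∧ y₁ = y₂ := by
  obtain ⟨lam, h, hs⟩ := h.exists_orientation S s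
  have hx : x₁ = x₂ := by
    by_contra hne
    rcases h.conj.total (not_le_of_covBy h₁.2.2.2.1 h₂.2.2.2.1 hne)
      (not_le_of_covBy h₂.2.2.2.1 h₁.2.2.2.1 (Ne.symm hne)) with h3 | h3
    · exact h.not_lam_of_squares h₂ h₁ (h.lam_of_leg hs hl h₂.2.2.2.1 h₂.1) h3
    · exact h.not_lam_of_squares h₁ h₂ (h.lam_of_leg hs hl h₁.2.2.2.1 h₁.1) h3
  subst hx
  exact ⟨rfl, h₁.inf_eq_and_sup_eq.1.symm.trans h₂.inf_eq_and_sup_eq.1⟩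

/-- One step down a leg. -/
def _root_.CoveringSquare.LegStep (S : CoveringSquare L) (s : Side) (p q : L × L) : Prop :=
  S.Leg s p.1 p.2 ∧ IsCoveringSquare q.2 q.1 p.2 p.1

theorem _root_.CoveringSquare.Leg.reflTransGen (hl : S.Leg s x y) :
    Relation.ReflTransGen (S.LegStep s) (S.side s, S.o) (x, y) := by
  induction hl with
  | base => exact .refl
  | step hl hsq ih => exact ih.tail ⟨hl, hsq⟩

theorem le_of_reflTransGen_legStep {p q : L × L} (h : Relation.ReflTransGen (S.LegStep s) p q) :
    q.1 ≤ p.1 := by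
  induction h with
  | refl => exact le_rfl
  | tail _ h ih => exact h.2.2.2.2.1.le.trans ih

theorem reflTransGen_of_le (h : IsOrientedSPS lam) {x' y' : L} (hl : S.Leg s x y)
    (hl' : S.Leg s x' y') (hle : x' ≤ x) : Relation.ReflTransGen (S.LegStep s) (x, y) (x', y') := by
  have hU : Relator.RightUnique (S.LegStep s) := fun p q r hq hr => by
    obtain ⟨h1, h2⟩ := h.square_unique hq.1 hq.2 hr.2
    exact Prod.ext h1 h2
  rcases Relation.ReflTransGen.total_of_right_unique hU hl.reflTransGen hl'.reflTransGen with h1 | h1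
  · exact h1
  · have h2 : x = x' := le_antisymm (le_of_reflTransGen_legStep h1) hle
    subst h2
    rw [← hl.inf_o, hl'.inf_o]

theorem leg_total (h : IsOrientedSPS lam) {x' y' : L} (hl : S.Leg s x y) (hl' : S.Leg s x' y') :
    x ≤ x' ∨ x' ≤ x := by
  have hU : Relator.RightUnique (S.LegStep s) := fun p q r hq hr => by
    obtain ⟨h1, h2⟩ := h.square_unique hq.1 hq.2 hr.2
    exact Prod.ext h1 h2
  rcases Relation.ReflTransGen.total_of_right_unique hU hl.reflTransGen hl'.reflTransGen with h1 | h1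
  · exact Or.inr (le_of_reflTransGen_legStep h1)
  · exact Or.inl (le_of_reflTransGen_legStep h1)

/-- In a leg, the successor of `x` is the largest element below `x`. -/
theorem leg_le_of_lt (h : IsOrientedSPS lam) {x₁ y₁ x' y' : L} (hl : S.Leg s x y)
    (hsq : IsCoveringSquare y' x' y x) (hl₁ : S.Leg s x₁ y₁) (hlt : x₁ < x) : x₁ ≤ x' := by
  rcases Relation.ReflTransGen.cases_head (h.reflTransGen_of_le hl hl₁ hlt.le) with h1 | ⟨p, hp, h1⟩
  · exact absurd (congrArg Prod.fst h1) hlt.ne'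
  · rw [(h.square_unique hl hsq hp.2).1]
    exact le_of_reflTransGen_legStep h1

/-- A leg continues at `(x, y)` if `x` has a lower cover different from `y`; it continues with the
lower cover of `x` next to `y`. -/
theorem exists_square (h : IsOrientedSPS lam) (hs : lam (S.side s) (S.side s.opp))
    (hl : S.Leg s x y) {e : L} (he : e ⋖ x) (hey : e ≠ y) :
    ∃ x' y', IsCoveringSquare y' x' y x ∧ (e = x' ∨ lam e x') := by
  have := h.finite
  have : IsTrans L (fun a b => lam b a) := ⟨fun _ _ _ hab hbc => h.conj.trans hbc hab⟩
  have : Std.Irrefl (fun a b => lam b a) := ⟨fun a ha => h.conj.not_le ha le_rfl⟩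
  have wf : WellFounded (fun a b : L => lam b a) := Finite.wellFounded_of_trans_of_irrefl _
  -- The well-founded relation is reversed, so a minimal element is one with no candidate to its
  -- right.
  obtain ⟨x', ⟨hx', hx'y, hex'⟩, hmax⟩ := wf.has_min {c | c ⋖ x ∧ c ≠ y ∧ (e = c ∨ lam e c)}
    ⟨e, he, hey, Or.inl rfl⟩
  have hyx := hl.covBy
  have hlam := h.lam_of_leg hs hl hx' hx'y
  obtain ⟨f, hrf, hfx⟩ := exists_covBy_le_of_lt (lt_of_le_of_ne inf_le_left fun e =>
    not_le_of_covBy hx' hyx hx'y (inf_eq_left.mp e) : x' ⊓ y < x')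
  obtain ⟨g, hrg, hgy⟩ := exists_covBy_le_of_lt (lt_of_le_of_ne inf_le_right fun e =>
    not_le_of_covBy hyx hx' hx'y.symm (inf_eq_right.mp e) : x' ⊓ y < y)
  have hfy : ¬ f ≤ y := fun hfy => hrf.lt.not_ge (le_inf hfx hfy)
  have hgx : ¬ g ≤ x' := fun hgx => hrg.lt.not_ge (le_inf hgx hgy)
  have hfg : f ≠ g := fun e => hfy (e ▸ hgy)
  -- A lower cover of `x` above both `f` and `g` would either have `x'` between it and `y`, forcing
  -- `g ≤ x'`, or lie to the right of `x'`, against the choice of `x'`. Semimodularity then makes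
  -- `f` and `g` lower covers of `x`, so they equal `x'` and `y`.
  have hfgx : f ⊔ g = x := by
    by_contra hne
    have hlt : f ⊔ g < x :=
      lt_of_le_of_ne (sup_le (hfx.trans hx'.le) (hgy.trans hyx.le)) hne
    obtain ⟨c, hfgc, hcx⟩ := exists_le_covBy_of_lt hlt
    have hcx' : c ≠ x' := fun e => hgx (e ▸ le_sup_right.trans hfgc)
    have hcy : c ≠ y := fun e => hfy (e ▸ le_sup_left.trans hfgc)
    rcases h.conj.total (not_le_of_covBy hcx hx' hcx') (not_le_of_covBy hx' hcx hcx'.symm)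
      with h1 | h1
    · exact hgx (h.conj.ge_of_between h1 hlam (le_sup_right.trans hfgc) hgy)
    · refine hmax c ⟨hcx, hcy, Or.inr ?_⟩ h1
      rcases hex' with rfl | hex'
      · exact h1
      · exact h.conj.trans hex' h1
  have hif := inf_eq_of_covBy hrf hrg hfg
  have hgc : g ⋖ x := hfgx ▸ h.covBy_sup (by rwa [hif])
  have hfc : f ⋖ x := by
    have := h.covBy_sup (a := g) (b := f) (by rwa [inf_comm, hif])
    rwa [sup_comm, hfgx] at this
  have hfx' : x' = f := (hfc.eq_or_eq hfx hx'.le).resolve_right hx'.ne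
  have hgy' : y = g := (hgc.eq_or_eq hgy hyx.le).resolve_right hyx.ne
  refine ⟨x', x' ⊓ y, ⟨hx'y, ?_, ?_, hx', hyx⟩, hex'⟩
  · nth_rewrite 2 [hfx']; exact hrf
  · nth_rewrite 2 [hgy']; exact hrg

/-- The interval from `y` to `o` is a chain that consists of elements of the leg. -/
theorem exists_leg_of_le (h : IsOrientedSPS lam) (hl : S.Leg s x y) :
    ∀ {c : L}, y ≤ c → c ≤ S.o → ∃ x', S.Leg s x' c := by
  have := h.finite
  induction hl with
  | base => exact fun h1 h2 => ⟨_, le_antisymm h1 h2 ▸ Leg.base⟩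
  | step hl hsq ih =>
    intro c h1 h2
    rcases h1.eq_or_lt with rfl | h1
    · exact ⟨_, Leg.step hl hsq⟩
    · obtain ⟨d, hd, hdc⟩ := exists_covBy_le_of_lt h1
      rcases h.eq_or_eq_of_covBy hsq.2.1 hsq.2.2.1 hd hsq.1 with rfl | rfl
      · exact absurd (hdc.trans h2) (Leg.step hl hsq).not_le_o
      · exact ih hdc h2

/-- The bottom `y'` of a step has only the covers `x'` and `y`, and `x'` is not below `o`. So either
`d ≤ y'` and the join is `x'`, or `y' ⊔ d` is above `y` and the join climbs one step up the leg. -/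
theorem exists_leg_sup (h : IsOrientedSPS lam) (hl : S.Leg s x y) {d : L} (hd : d ≤ S.o) :
    ∃ y', S.Leg s (x ⊔ d) y' := by
  have := h.finite
  induction hl with
  | base => exact ⟨S.o, by
      rw [sup_eq_left.mpr (hd.trans (S.isCoveringSquare_side s).2.1.le)]; exact Leg.base⟩
  | @step x y x' y' hl hsq ih =>
    by_cases hdy : d ≤ y'
    · exact ⟨y', by rw [sup_eq_left.mpr (hdy.trans hsq.2.1.le)]; exact Leg.step hl hsq⟩
    have hlt : y' < y' ⊔ d := lt_of_le_of_ne le_sup_left fun e => hdy (sup_eq_left.mp e.symm)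
    obtain ⟨c, hc, hcd⟩ := exists_covBy_le_of_lt hlt
    have hle : y' ⊔ d ≤ S.o := sup_le (Leg.step hl hsq).le_o hd
    rcases h.eq_or_eq_of_covBy hsq.2.1 hsq.2.2.1 hc hsq.1 with rfl | rfl
    · exact absurd (hcd.trans hle) (Leg.step hl hsq).not_le_o
    · have : x' ⊔ d = x ⊔ d := by
        refine le_antisymm (sup_le_sup_right hsq.2.2.2.1.le d) (sup_le ?_ le_sup_right)
        rw [← hsq.inf_eq_and_sup_eq.2]
        exact sup_le le_sup_left (hcd.trans (sup_le_sup_right hsq.2.1.le d))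
      rw [this]
      exact ih

theorem leg_sup_opp (h : IsOrientedSPS lam) {x' y' : L} (hl : S.Leg s x y)
    (hl' : S.Leg s.opp x' y') : x ⊔ x' = S.i := by
  have hc : y ⊔ y' ≤ S.o := sup_le hl.le_o hl'.le_o
  obtain ⟨u, hu⟩ := h.exists_leg_of_le hl le_sup_left hc
  obtain ⟨v, hv⟩ := h.exists_leg_of_le hl' le_sup_right hc
  have huv : u ≠ v := fun e => hu.not_le_opp hv e.le
  -- The element `y ⊔ y'` is a bottom on both legs. If it were not `o`, its covers would be `u`, `v`
  -- and the preceding bottom of the leg; these are distinct because the last is below `o` and the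
  -- others are not.
  have hco : y ⊔ y' = S.o := by
    generalize y ⊔ y' = c at *
    cases hu with
    | base => rfl
    | step hl hsq =>
      rcases h.eq_or_eq_of_covBy hsq.2.1 hsq.2.2.1 hv.covBy hsq.1 with rfl | rfl
      · exact absurd rfl huv
      · exact absurd hl.le_o hv.not_le_o
  have ho : S.o ≤ x ⊔ x' := hco ▸ sup_le_sup hl.covBy.le hl'.covBy.le
  refine le_antisymm (sup_le hl.lt_i.le hl'.lt_i.le) ?_
  rw [← S.side_sup_side s, ← hl.sup_o, ← hl'.sup_o]
  exact sup_le (sup_le le_sup_left ho) (sup_le le_sup_right ho)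

/-! ### Shadows of the low elements: joins and lower approximations -/

/-- The elements of `L` that are below `o`, on a leg, or equal to `i`. -/
def _root_.CoveringSquare.lowSet (S : CoveringSquare L) : Set L :=
  {a | a ≤ S.o ∨ a = S.i ∨ ∃ s y, S.Leg s a y}

theorem _root_.CoveringSquare.le_i_of_mem_lowSet {a : L} (ha : a ∈ S.lowSet) : a ≤ S.i := by
  rcases ha with ha | rfl | ⟨s, y, ha⟩
  · exact ha.trans S.o_lt_i.le
  · exact le_rfl
  · exact ha.lt_i.le

theorem sup_mem_lowSet (h : IsOrientedSPS lam) {a b : L} (ha : a ∈ S.lowSet) (hb : b ∈ S.lowSet) :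
    a ⊔ b ∈ S.lowSet := by
  have hai := le_i_of_mem_lowSet ha
  have hbi := le_i_of_mem_lowSet hb
  rcases ha with ha | rfl | ⟨s, y, ha⟩
  · rcases hb with hb | rfl | ⟨s', y', hb⟩
    · exact Or.inl (sup_le ha hb)
    · exact Or.inr (Or.inl (sup_eq_right.mpr hai))
    · obtain ⟨y, hy⟩ := h.exists_leg_sup hb ha
      exact Or.inr (Or.inr ⟨s', y, by rwa [sup_comm]⟩)
  · exact Or.inr (Or.inl (sup_eq_left.mpr hbi))
  · rcases hb with hb | rfl | ⟨s', y', hb⟩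
    · obtain ⟨y, hy⟩ := h.exists_leg_sup ha hb
      exact Or.inr (Or.inr ⟨s, y, hy⟩)
    · exact Or.inr (Or.inl (sup_eq_right.mpr hai))
    · rcases Side.eq_or_eq_opp s s' with rfl | rfl
      · rcases h.leg_total ha hb with h1 | h1
        · exact Or.inr (Or.inr ⟨_, y', by rwa [sup_eq_right.mpr h1]⟩)
        · exact Or.inr (Or.inr ⟨_, y, by rwa [sup_eq_left.mpr h1]⟩)
      · exact Or.inr (Or.inl (h.leg_sup_opp ha hb))

/-- Below an element of a leg, every element has a largest lower approximation in `S.lowSet`, and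
these two elements are congruent modulo the congruence `lowCon`. -/
theorem exists_approx_of_leg (h : IsOrientedSPS lam) (hl : S.Leg s x y) :
    ∀ {b : L}, b ≤ x →
      ∃ g ∈ S.lowSet, g ≤ b ∧ (∀ g' ∈ S.lowSet, g' ≤ b → g' ≤ g) ∧ LowEquiv S.i g b := by
  obtain ⟨lam, h, hs⟩ := h.exists_orientation S s
  have := h.finite
  induction x using WellFoundedLT.induction generalizing y with
  | ind x ih =>
  intro b hb
  by_cases hbo : b ≤ S.o
  · exact ⟨b, Or.inl hbo, le_rfl, fun _ _ => id, fun _ _ => Iff.rfl⟩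
  rcases hb.eq_or_lt with rfl | hb
  · exact ⟨b, Or.inr (Or.inr ⟨s, y, hl⟩), le_rfl, fun _ _ => id, fun _ _ => Iff.rfl⟩
  obtain ⟨e, hbe, he⟩ := exists_le_covBy_of_lt hb
  have hey : e ≠ y := fun e' => hbo (hbe.trans (e' ▸ hl.le_o))
  obtain ⟨x', y', hsq, hex'⟩ := h.exists_square hs hl he hey
  have hl' := Leg.step hl hsq
  -- If `e` is not `x'` itself, then `x'` is a middle lower cover, between `e` and `y`. It is thus
  -- congruent to `x`, and meeting with `b` gives the claim.
  have hbx : LowEquiv S.i (b ⊓ x') b := by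
    rcases hex' with rfl | hex'
    · rw [inf_eq_left.mpr hbe]; exact fun _ _ => Iff.rfl
    · have h1 := h.lowEquiv_inf_right (h.lowEquiv_of_middle he hsq.2.2.2.1 hl.covBy hex'
        (h.lam_of_leg hs hl hsq.2.2.2.1 hsq.1) hl.lt_i) b
      rwa [inf_comm, inf_eq_right.mpr hb.le] at h1
  obtain ⟨g, hg, hgb, hmax, hgeq⟩ := ih x' hsq.2.2.2.1.lt hl' (inf_le_right : b ⊓ x' ≤ x')
  refine ⟨g, hg, hgb.trans inf_le_left, fun g' hg' hgb' => ?_, hgeq.trans hbx⟩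
  -- No element of `lowSet` is lost by passing to `b ⊓ x'`: one below `o` is below both `e` and `y`,
  -- hence below `x'` by betweenness; one on the same leg is strictly below `x`, hence at most `x'`.
  refine hmax g' hg' (le_inf hgb' ?_)
  rcases hg' with hg' | rfl | ⟨s', y₁, hg'⟩
  · rcases hex' with rfl | hex'
    · exact hgb'.trans hbe
    · exact h.conj.ge_of_between hex' (h.lam_of_leg hs hl hsq.2.2.2.1 hsq.1) (hgb'.trans hbe)
        (hl.inf_o ▸ le_inf (hgb'.trans hb.le) hg')
  · exact absurd (hgb'.trans hb.le) hl.lt_i.not_ge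
  · rcases Side.eq_or_eq_opp s' s with rfl | rfl
    · exact h.leg_le_of_lt hl hsq hg' (hgb'.trans_lt hb)
    · exact absurd (hgb'.trans hb.le) (hg'.not_le_opp hl)

theorem exists_approx (h : IsOrientedSPS lam) (hS : S.IsTight) {a b : L} (ha : a ∈ S.lowSet)
    (hb : b ≤ a) :
    ∃ g ∈ S.lowSet, g ≤ b ∧ (∀ g' ∈ S.lowSet, g' ≤ b → g' ≤ g) ∧ LowEquiv S.i g b := by
  have := h.finite
  rcases ha with ha | rfl | ⟨s, y, ha⟩
  · exact ⟨b, Or.inl (hb.trans ha), le_rfl, fun _ _ => id, fun _ _ => Iff.rfl⟩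
  · rcases hb.eq_or_lt with rfl | hb
    · exact ⟨S.i, Or.inr (Or.inl rfl), le_rfl, fun _ _ => id, fun _ _ => Iff.rfl⟩
    · obtain ⟨e, hbe, he⟩ := exists_le_covBy_of_lt hb
      rcases (hS e).mp he with rfl | rfl
      · exact h.exists_approx_of_leg (Leg.base (s := Side.left)) hbe
      · exact h.exists_approx_of_leg (Leg.base (s := Side.right)) hbe
  · exact h.exists_approx_of_leg ha hb

/-- Otherwise `o` would be congruent to one of its covers, which can only be the sides of `S`.
Joining with the opposite side would make that side congruent to `i`, but the congruence collapses
only intervals with top strictly below `i`. -/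
theorem le_o_of_lowEquiv (h : IsOrientedSPS lam) {a b : L} (hab : LowEquiv S.i a b)
    (ha : a ≤ S.o) : b ≤ S.o := by
  have := h.finite
  by_contra hb
  have h1 : LowEquiv S.i (a ⊔ S.o) (b ⊔ S.o) := (h.lowCon S.i).sup hab ((h.lowCon S.i).refl S.o)
  rw [sup_eq_right.mpr ha] at h1
  obtain ⟨c, hc, hcb⟩ := exists_covBy_le_of_lt
    (lt_of_le_of_ne le_sup_right fun e => hb (sup_eq_right.mp e.symm) : S.o < b ⊔ S.o)
  have h2 : LowEquiv S.i S.o c := fun m hm =>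
    ⟨fun h' => hcb.trans ((h1 m hm).mp h'), fun h' => hc.le.trans h'⟩
  have key : ∀ s, c ≠ S.side s := by
    rintro s rfl
    have h3 : LowEquiv S.i (S.o ⊔ S.side s.opp) (S.side s ⊔ S.side s.opp) :=
      (h.lowCon S.i).sup h2 ((h.lowCon S.i).refl _)
    obtain ⟨-, -, h4, -, h5⟩ := S.isCoveringSquare_side s
    rw [S.side_sup_side, sup_eq_right.mpr h4.le] at h3
    exact lt_irrefl _ (h.lt_of_lowEquiv h5.lt h3)
  obtain ⟨h3, h4, h5, -, -⟩ := S.isCoveringSquare_side Side.left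
  rcases h.eq_or_eq_of_covBy h4 h5 hc h3 with h6 | h6
  · exact key _ h6
  · exact key _ h6

end IsOrientedSPS

/-! ## The conjugate order of a planar diagram -/

/-- A straight-line diagram of a poset without crossing edges. -/
structure IsPlanarDiagram {L : Type*} [PartialOrder L] (φ : L → ℝ × ℝ) : Prop where
  injective : Function.Injective φ
  lt : ∀ a b : L, a < b → (φ a).2 < (φ b).2
  crossing : ∀ a b c d : L, a ⋖ b → c ⋖ d → (a, b) ≠ (c, d) →
      ∀ P : ℝ × ℝ, P ∈ segment ℝ (φ a) (φ b) → P ∈ segment ℝ (φ c) (φ d) →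
        ∃ e : L, (e = a ∨ e = b) ∧ (e = c ∨ e = d) ∧ P = φ e

/-- The points of the vertices and edges of the diagram that belong to the interval `[a, b]`. -/
def diagramPoints {L : Type*} [PartialOrder L] (φ : L → ℝ × ℝ) (a b : L) : Set (ℝ × ℝ) :=
  {P | (∃ c, a ≤ c ∧ c ≤ b ∧ P = φ c) ∨
    ∃ c d, a ≤ c ∧ c ⋖ d ∧ d ≤ b ∧ P ∈ segment ℝ (φ c) (φ d)}

theorem diagramPoints_mono {L : Type*} [PartialOrder L] {φ : L → ℝ × ℝ} {a b a' b' : L}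
    (ha : a' ≤ a) (hb : b ≤ b') : diagramPoints φ a b ⊆ diagramPoints φ a' b' := by
  rintro P (⟨c, h1, h2, h3⟩ | ⟨c, d, h1, h2, h3, h4⟩)
  · exact Or.inl ⟨c, ha.trans h1, h2.trans hb, h3⟩
  · exact Or.inr ⟨c, d, ha.trans h1, h2, h3.trans hb, h4⟩

/-- `IsTrace φ v F` says that the graph of `F`, as a function of the height, runs from the bottom to
the top of the diagram through the vertex `v`, along edges below `v` and then along edges
above `v`. -/
structure IsTrace {L : Type*} [PartialOrder L] [BoundedOrder L] (φ : L → ℝ × ℝ) (v : L)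
    (F : ℝ → ℝ) : Prop where
  continuous : Continuous F
  apply_vertex : F (φ v).2 = (φ v).1
  below : ∀ s ∈ Set.Icc (φ ⊥).2 (φ v).2, (F s, s) ∈ diagramPoints φ ⊥ v
  above : ∀ s ∈ Set.Icc (φ v).2 (φ ⊤).2, (F s, s) ∈ diagramPoints φ v ⊤

theorem exists_continuous_concat {F G : ℝ → ℝ} (hF : Continuous F) (hG : Continuous G) {y : ℝ}
    (hy : F y = G y) :
    ∃ H : ℝ → ℝ, Continuous H ∧ (∀ s ≤ y, H s = F s) ∧ ∀ s, y ≤ s → H s = G s := by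
  refine ⟨fun s => if s ≤ y then F s else G s,
    Continuous.if_le hF hG continuous_id continuous_const ?_, fun s hs => if_pos hs,
    fun s hs => ?_⟩
  · rintro s rfl; exact hy
  · rcases hs.eq_or_lt with rfl | hs
    · simpa using hy
    · exact if_neg hs.not_ge

namespace IsPlanarDiagram

variable {L : Type*} [PartialOrder L] {φ : L → ℝ × ℝ}

theorem le (h : IsPlanarDiagram φ) {a b : L} (hab : a ≤ b) : (φ a).2 ≤ (φ b).2 := by
  rcases hab.eq_or_lt with rfl | hab
  · exact le_rfl
  · exact (h.lt _ _ hab).le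

theorem exists_path_of_covBy (h : IsPlanarDiagram φ) {a b : L} (hab : a ⋖ b) :
    ∃ F : ℝ → ℝ, Continuous F ∧ F (φ a).2 = (φ a).1 ∧ F (φ b).2 = (φ b).1 ∧
      ∀ s ∈ Set.Icc (φ a).2 (φ b).2, (F s, s) ∈ diagramPoints φ a b := by
  have hlt := h.lt a b hab.lt
  have hpos : 0 < (φ b).2 - (φ a).2 := sub_pos.mpr hlt
  refine ⟨fun s => (φ a).1 + (s - (φ a).2) / ((φ b).2 - (φ a).2) * ((φ b).1 - (φ a).1),
    by fun_prop, by simp, by field_simp; ring, fun s hs => ?_⟩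
  refine Or.inr ⟨a, b, le_rfl, hab, le_rfl, ?_⟩
  rw [segment_eq_image']
  refine ⟨(s - (φ a).2) / ((φ b).2 - (φ a).2),
    ⟨div_nonneg (sub_nonneg.mpr hs.1) hpos.le, (div_le_one hpos).mpr (by linarith [hs.2])⟩, ?_⟩
  refine Prod.ext ?_ ?_
  · simp
  · simp only [Prod.snd_add, Prod.smul_snd, Prod.snd_sub, smul_eq_mul]
    field_simp
    ring

theorem exists_path_trans {a b c : L} (hab : a ≤ b) (hbc : b ≤ c) {F G : ℝ → ℝ}
    (hF : Continuous F) (hG : Continuous G) (hFb : F (φ b).2 = (φ b).1)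
    (hGb : G (φ b).2 = (φ b).1)
    (hF' : ∀ s ∈ Set.Icc (φ a).2 (φ b).2, (F s, s) ∈ diagramPoints φ a b)
    (hG' : ∀ s ∈ Set.Icc (φ b).2 (φ c).2, (G s, s) ∈ diagramPoints φ b c) :
    ∃ H : ℝ → ℝ, Continuous H ∧ (∀ s ≤ (φ b).2, H s = F s) ∧ (∀ s, (φ b).2 ≤ s → H s = G s) ∧
      ∀ s ∈ Set.Icc (φ a).2 (φ c).2, (H s, s) ∈ diagramPoints φ a c := by
  obtain ⟨H, h1, h2, h3⟩ := exists_continuous_concat hF hG (hFb.trans hGb.symm)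
  refine ⟨H, h1, h2, h3, fun s hs => ?_⟩
  rcases le_total s (φ b).2 with h4 | h4
  · rw [h2 s h4]; exact diagramPoints_mono le_rfl hbc (hF' s ⟨hs.1, h4⟩)
  · rw [h3 s h4]; exact diagramPoints_mono hab le_rfl (hG' s ⟨h4, hs.2⟩)

theorem exists_path [Finite L] (h : IsPlanarDiagram φ) {a b : L} (hab : a ≤ b) :
    ∃ F : ℝ → ℝ, Continuous F ∧ F (φ a).2 = (φ a).1 ∧ F (φ b).2 = (φ b).1 ∧
      ∀ s ∈ Set.Icc (φ a).2 (φ b).2, (F s, s) ∈ diagramPoints φ a b := by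
  induction a using WellFoundedGT.induction with
  | ind a ih =>
  rcases hab.eq_or_lt with rfl | hab
  · refine ⟨fun _ => (φ a).1, continuous_const, rfl, rfl, fun s hs => Or.inl ⟨a, le_rfl, le_rfl, ?_⟩⟩
    exact Prod.ext rfl (le_antisymm hs.2 hs.1)
  · obtain ⟨c, hac, hcb⟩ := exists_covBy_le_of_lt hab
    obtain ⟨F, h1, h2, h3, h4⟩ := h.exists_path_of_covBy hac
    obtain ⟨G, h5, h6, h7, h8⟩ := ih c hac.lt hcb
    obtain ⟨H, h9, h10, h11, h12⟩ := exists_path_trans hac.le hcb h1 h5 h3 h6 h4 h8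
    exact ⟨H, h9, by rw [h10 _ (h.le hac.le), h2], by rw [h11 _ (h.le hcb), h7], h12⟩

variable [BoundedOrder L]

theorem exists_trace_of_le [Finite L] (h : IsPlanarDiagram φ) {a b : L} (hab : a ≤ b) :
    ∃ F : ℝ → ℝ, IsTrace φ a F ∧ IsTrace φ b F := by
  obtain ⟨F, f1, f2, f3, f4⟩ := h.exists_path (bot_le : ⊥ ≤ a)
  obtain ⟨G, g1, g2, g3, g4⟩ := h.exists_path hab
  obtain ⟨H, h1, h2, h3, h4⟩ := h.exists_path (le_top : b ≤ ⊤)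
  obtain ⟨K, k1, k2, k3, k4⟩ := exists_path_trans bot_le hab f1 g1 f3 g2 f4 g4
  obtain ⟨M, m1, m2, m3, m4⟩ := exists_path_trans bot_le le_top k1 h1
    (by rw [k3 _ (h.le hab), g3]) h2 k4 h4
  have hle := h.le hab
  have hb := h.le (bot_le : ⊥ ≤ b)
  refine ⟨M, ⟨m1, by rw [m2 _ hle, k2 _ le_rfl, f3], fun s hs => ?_, fun s hs => ?_⟩,
    ⟨m1, by rw [m3 _ le_rfl, h2], fun s hs => ?_, fun s hs => ?_⟩⟩
  · rw [m2 s (hs.2.trans hle), k2 s hs.2]; exact f4 s hs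
  · rcases le_total s (φ b).2 with h5 | h5
    · rw [m2 s h5, k3 s hs.1]; exact diagramPoints_mono le_rfl le_top (g4 s ⟨hs.1, h5⟩)
    · rw [m3 s h5]; exact diagramPoints_mono hab le_rfl (h4 s ⟨h5, hs.2⟩)
  · rw [m2 s hs.2]; exact k4 s hs
  · rw [m3 s hs.1]; exact h4 s hs

theorem exists_trace [Finite L] (h : IsPlanarDiagram φ) (a : L) : ∃ F : ℝ → ℝ, IsTrace φ a F :=
  (h.exists_trace_of_le (le_refl a)).imp fun _ => And.left

/-- A vertex on an edge is an endpoint of the edge. -/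
theorem eq_or_eq_of_mem_segment [Finite L] (h : IsPlanarDiagram φ) {v c d : L} (hcd : c ⋖ d)
    (hv : φ v ∈ segment ℝ (φ c) (φ d)) : v = c ∨ v = d := by
  by_contra! hne
  -- The non-crossing condition concerns pairs of edges, so `v` is first placed on an edge of its
  -- own: an upward one, or a downward one if `v` is the top.
  rcases (le_top : v ≤ ⊤).eq_or_lt with rfl | hlt
  · obtain ⟨w, -, hw⟩ := exists_le_covBy_of_lt (lt_of_lt_of_le hcd.lt le_top)
    obtain ⟨e, -, he, hve⟩ := h.crossing _ _ c d hw hcd (fun e => hne.2 (congrArg Prod.snd e)) _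
      (right_mem_segment ℝ _ _) hv
    have := h.injective hve
    subst this
    exact he.elim hne.1 hne.2
  · obtain ⟨w, hw, -⟩ := exists_covBy_le_of_lt hlt
    obtain ⟨e, -, he, hve⟩ := h.crossing _ _ c d hw hcd (fun e => hne.1 (congrArg Prod.fst e)) _
      (left_mem_segment ℝ _ _) hv
    have := h.injective hve
    subst this
    exact he.elim hne.1 hne.2

/-- Distinct edges share only common endpoints, so a shared point is a vertex or lies on a shared
edge. Following edges up from `a` and on up to `b` then gives a chain. -/
theorem le_of_mem_diagramPoints [Finite L] (h : IsPlanarDiagram φ) {a b : L} {P : ℝ × ℝ}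
    (ha : P ∈ diagramPoints φ a ⊤) (hb : P ∈ diagramPoints φ ⊥ b) : a ≤ b := by
  rcases ha with ⟨c, hac, -, rfl⟩ | ⟨c, d, hac, hcd, -, hP⟩
  · rcases hb with ⟨c', -, hcb, hcc⟩ | ⟨c', d', -, hcd, hdb, hP⟩
    · rw [h.injective hcc] at hac; exact hac.trans hcb
    · rcases h.eq_or_eq_of_mem_segment hcd hP with rfl | rfl
      · exact hac.trans (hcd.le.trans hdb)
      · exact hac.trans hdb
  · rcases hb with ⟨c', -, hcb, rfl⟩ | ⟨c', d', -, hcd', hdb, hP'⟩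
    · rcases h.eq_or_eq_of_mem_segment hcd hP with rfl | rfl
      · exact hac.trans hcb
      · exact hac.trans (hcd.le.trans hcb)
    · by_cases he : (c, d) = (c', d')
      · cases he; exact hac.trans (hcd.le.trans hdb)
      · obtain ⟨e, h1, h2, -⟩ := h.crossing c d c' d' hcd hcd' he P hP hP'
        have h3 : c ≤ e := by rcases h1 with rfl | rfl; exacts [le_rfl, hcd.le]
        have h4 : e ≤ d' := by rcases h2 with rfl | rfl; exacts [hcd'.le, le_rfl]
        exact hac.trans (h3.trans (h4.trans hdb))

variable [Finite L]

/-- At heights between the two vertices, the trace of the lower vertex runs above that vertex and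
the other trace runs below its own. A common point would make the vertices comparable. -/
theorem trace_ne (h : IsPlanarDiagram φ) {a b : L} (hab : ¬ a ≤ b) (hba : ¬ b ≤ a) {F G : ℝ → ℝ}
    (hF : IsTrace φ a F) (hG : IsTrace φ b G) {s : ℝ} (hs : s ∈ Set.uIcc (φ a).2 (φ b).2) :
    F s ≠ G s := by
  intro he
  rcases le_total (φ a).2 (φ b).2 with h1 | h1
  · rw [Set.uIcc_of_le h1] at hs
    have h2 := hF.above s ⟨hs.1, hs.2.trans (h.le le_top)⟩
    rw [he] at h2
    exact hab (h.le_of_mem_diagramPoints h2 (hG.below s ⟨(h.le bot_le).trans hs.1, hs.2⟩))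
  · rw [Set.uIcc_of_ge h1] at hs
    have h2 := hG.above s ⟨hs.1, hs.2.trans (h.le le_top)⟩
    rw [← he] at h2
    exact hba (h.le_of_mem_diagramPoints h2 (hF.below s ⟨(h.le bot_le).trans hs.1, hs.2⟩))

theorem trace_lt (h : IsPlanarDiagram φ) {a b : L} (hab : ¬ a ≤ b) (hba : ¬ b ≤ a) {F G : ℝ → ℝ}
    (hF : IsTrace φ a F) (hG : IsTrace φ b G) {s s' : ℝ} (hs : s ∈ Set.uIcc (φ a).2 (φ b).2)
    (hs' : s' ∈ Set.uIcc (φ a).2 (φ b).2) (hlt : F s < G s) : F s' < G s' := by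
  by_contra hge
  have hc : ContinuousOn (fun u => G u - F u) (Set.uIcc s s') :=
    (hG.continuous.sub hF.continuous).continuousOn
  have h0 : (0 : ℝ) ∈ Set.uIcc (G s - F s) (G s' - F s') := by
    rw [Set.mem_uIcc]; right; constructor <;> linarith
  obtain ⟨u, hu, hu0⟩ := intermediate_value_uIcc hc h0
  exact h.trace_ne hab hba hF hG (Set.uIcc_subset_uIcc hs hs' hu) (by simp only at hu0; linarith)

end IsPlanarDiagram

/-- The vertex `a` is incomparable to `b` and to the left of `b`. -/
def LeftOf {L : Type*} [PartialOrder L] [BoundedOrder L] (φ : L → ℝ × ℝ) (a b : L) : Prop :=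
  ¬ a ≤ b ∧ ¬ b ≤ a ∧ ∃ F, IsTrace φ a F ∧ F (φ b).2 < (φ b).1

/-! ### The left-of relation is a conjugate order -/

namespace IsPlanarDiagram

variable {L : Type*} [PartialOrder L] [BoundedOrder L] [Finite L] {φ : L → ℝ × ℝ}

theorem trace_lt_of_leftOf (h : IsPlanarDiagram φ) {a b : L} (hab : LeftOf φ a b) {F G : ℝ → ℝ}
    (hF : IsTrace φ a F) (hG : IsTrace φ b G) {s : ℝ} (hs : s ∈ Set.uIcc (φ a).2 (φ b).2) :
    F s < G s := by
  obtain ⟨h1, h2, F', hF', h3⟩ := hab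
  have h4 : F' (φ a).2 < G (φ a).2 := by
    refine h.trace_lt h1 h2 hF' hG Set.right_mem_uIcc Set.left_mem_uIcc ?_
    rwa [hG.apply_vertex]
  refine h.trace_lt h1 h2 hF hG Set.left_mem_uIcc hs ?_
  rwa [hF.apply_vertex, ← hF'.apply_vertex]

theorem left_lt (h : IsPlanarDiagram φ) {a b : L} (hab : LeftOf φ a b) {F : ℝ → ℝ}
    (hF : IsTrace φ a F) : F (φ b).2 < (φ b).1 := by
  obtain ⟨G, hG⟩ := h.exists_trace b
  rw [← hG.apply_vertex]
  exact h.trace_lt_of_leftOf hab hF hG Set.right_mem_uIcc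

theorem lt_right (h : IsPlanarDiagram φ) {a b : L} (hab : LeftOf φ a b) {G : ℝ → ℝ}
    (hG : IsTrace φ b G) : (φ a).1 < G (φ a).2 := by
  obtain ⟨F, hF⟩ := h.exists_trace a
  rw [← hF.apply_vertex]
  exact h.trace_lt_of_leftOf hab hF hG Set.left_mem_uIcc

theorem leftOf_total (h : IsPlanarDiagram φ) {a b : L} (hab : ¬ a ≤ b) (hba : ¬ b ≤ a) :
    LeftOf φ a b ∨ LeftOf φ b a := by
  obtain ⟨F, hF⟩ := h.exists_trace a
  obtain ⟨G, hG⟩ := h.exists_trace b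
  rcases lt_trichotomy (F (φ b).2) (φ b).1 with h1 | h1 | h1
  · exact Or.inl ⟨hab, hba, F, hF, h1⟩
  · exact absurd (h1.trans hG.apply_vertex.symm) (h.trace_ne hab hba hF hG Set.right_mem_uIcc)
  · refine Or.inr ⟨hba, hab, G, hG, ?_⟩
    rw [← hF.apply_vertex]
    refine h.trace_lt hba hab hG hF Set.left_mem_uIcc Set.right_mem_uIcc ?_
    rwa [hG.apply_vertex]

theorem not_cycle_of_mem_uIcc (h : IsPlanarDiagram φ) {a b c : L} (hab : LeftOf φ a b)
    (hbc : LeftOf φ b c) (hca : LeftOf φ c a) (hb : (φ b).2 ∈ Set.uIcc (φ c).2 (φ a).2) : False := by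
  obtain ⟨F, hF⟩ := h.exists_trace a
  obtain ⟨G, hG⟩ := h.exists_trace c
  exact lt_asymm ((h.left_lt hab hF).trans (h.lt_right hbc hG)) (h.trace_lt_of_leftOf hca hG hF hb)

/-- One of the three vertices has height between the other two. At that height the traces of the
other two pass it on opposite sides, in the order contrary to the third relation of the cycle. -/
theorem not_cycle (h : IsPlanarDiagram φ) {a b c : L} (hab : LeftOf φ a b) (hbc : LeftOf φ b c)
    (hca : LeftOf φ c a) : False := by
  rcases le_total (φ a).2 (φ b).2 with h1 | h1 <;> rcases le_total (φ b).2 (φ c).2 with h2 | h2 <;>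
    rcases le_total (φ c).2 (φ a).2 with h3 | h3
  · exact h.not_cycle_of_mem_uIcc hab hbc hca (Set.mem_uIcc.mpr (by right; constructor <;> linarith))
  · exact h.not_cycle_of_mem_uIcc hab hbc hca (Set.mem_uIcc.mpr (by right; constructor <;> linarith))
  · exact h.not_cycle_of_mem_uIcc hca hab hbc (Set.mem_uIcc.mpr (by right; constructor <;> linarith))
  · exact h.not_cycle_of_mem_uIcc hbc hca hab (Set.mem_uIcc.mpr (by left; constructor <;> linarith))
  · exact h.not_cycle_of_mem_uIcc hbc hca hab (Set.mem_uIcc.mpr (by right; constructor <;> linarith))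
  · exact h.not_cycle_of_mem_uIcc hca hab hbc (Set.mem_uIcc.mpr (by left; constructor <;> linarith))
  · exact h.not_cycle_of_mem_uIcc hab hbc hca (Set.mem_uIcc.mpr (by left; constructor <;> linarith))
  · exact h.not_cycle_of_mem_uIcc hab hbc hca (Set.mem_uIcc.mpr (by left; constructor <;> linarith))

theorem isConjugateOrder (h : IsPlanarDiagram φ) : IsConjugateOrder (LeftOf φ) where
  trans {a b c} hab hbc := by
    -- If `a` and `c` were comparable, one trace would pass through both, and at the height of `b`
    -- it would be both left and right of `b`.
    by_cases hac : a ≤ c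
    · obtain ⟨F, h1, h2⟩ := h.exists_trace_of_le hac
      exact absurd (h.lt_right hbc h2) (h.left_lt hab h1).le.not_gt
    by_cases hca : c ≤ a
    · obtain ⟨F, h1, h2⟩ := h.exists_trace_of_le hca
      exact absurd (h.lt_right hbc h1) (h.left_lt hab h2).le.not_gt
    exact (h.leftOf_total hac hca).resolve_right (h.not_cycle hab hbc)
  not_le h := h.1
  not_ge h := h.2.1
  total := h.leftOf_total

end IsPlanarDiagram

theorem IsSPS.exists_isOrientedSPS {L : Type*} [Lattice L] [Nonempty L] (hL : IsSPS L) :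
    ∃ lam : L → L → Prop, IsOrientedSPS lam := by
  obtain ⟨hf, φ, h1, h2, h3⟩ := hL.planar
  have := Fintype.ofFinite L
  let : BoundedOrder L := Fintype.toBoundedOrder L
  exact ⟨_, hL.slim, hf, hL.semimodular, IsPlanarDiagram.isConjugateOrder ⟨h1, h2, h3⟩⟩

/-! ## The order of the fork extension -/

namespace CoveringSquare

variable {L : Type*} [Lattice L] {S : CoveringSquare L}

/-- The least element of `L` above an element of `L[S]`. -/
def Fork.shadow : S.Fork → L
  | Fork.old a => a
  | Fork.t => S.i
  | Fork.z _ x _ _ => x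

/-- The elements of `L` that are not below `o`; these are the elements of `L[S]` not below `t`. -/
def Fork.IsHigh : S.Fork → Prop
  | Fork.old a => ¬ a ≤ S.o
  | Fork.t => False
  | Fork.z _ _ _ _ => False

namespace Fork

@[simp] theorem shadow_old (a : L) : (Fork.old a : S.Fork).shadow = a := rfl
@[simp] theorem shadow_t : (Fork.t : S.Fork).shadow = S.i := rfl
@[simp] theorem shadow_z (s : Side) (x y : L) (h : S.Leg s x y) :
    (Fork.z s x y h : S.Fork).shadow = x := rfl
@[simp] theorem isHigh_old (a : L) : (Fork.old a : S.Fork).IsHigh ↔ ¬ a ≤ S.o := Iff.rfl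
@[simp] theorem isHigh_t : ¬ (Fork.t : S.Fork).IsHigh := id
@[simp] theorem isHigh_z (s : Side) (x y : L) (h : S.Leg s x y) :
    ¬ (Fork.z s x y h : S.Fork).IsHigh := id

theorem IsHigh.eq_old {p : S.Fork} (hp : p.IsHigh) : p = Fork.old p.shadow := by
  cases p with
  | old a => rfl
  | t => exact hp.elim
  | z s x y h => exact hp.elim

theorem IsHigh.not_le {p : S.Fork} (hp : p.IsHigh) : ¬ p.shadow ≤ S.o := by
  cases p with
  | old a => exact hp
  | t => exact hp.elim
  | z s x y h => exact hp.elim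

theorem shadow_mem_lowSet {p : S.Fork} (hp : ¬ p.IsHigh) : p.shadow ∈ S.lowSet := by
  cases p with
  | old a => exact Or.inl (not_not.mp hp)
  | t => exact Or.inr (Or.inl rfl)
  | z s x y h => exact Or.inr (Or.inr ⟨s, y, h⟩)

theorem exists_of_mem_lowSet {a : L} (ha : a ∈ S.lowSet) :
    ∃ p : S.Fork, p.shadow = a ∧ ¬ p.IsHigh := by
  rcases ha with ha | rfl | ⟨s, y, h⟩
  · exact ⟨Fork.old a, rfl, not_not.mpr ha⟩
  · exact ⟨Fork.t, rfl, id⟩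
  · exact ⟨Fork.z s a y h, rfl, id⟩

theorem ext_shadow {p q : S.Fork} (h1 : p.shadow = q.shadow) (h2 : p.IsHigh ↔ q.IsHigh) :
    p = q := by
  rcases p with a | _ | ⟨s, x, y, h⟩ <;> rcases q with b | _ | ⟨s', x', y', h'⟩ <;>
    simp only [shadow_old, shadow_t, shadow_z, isHigh_old, isHigh_t, isHigh_z, iff_false, false_iff,
      not_not] at h1 h2
  · rw [h1]
  · exact absurd (h1 ▸ h2) S.o_lt_i.not_ge
  · exact absurd (h1 ▸ h2) h'.not_le_o
  · exact absurd (h1 ▸ h2) S.o_lt_i.not_ge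
  · rfl
  · exact absurd h1 h'.lt_i.ne'
  · exact absurd (h1 ▸ h2) h.not_le_o
  · exact absurd h1 h.lt_i.ne
  · subst h1
    obtain rfl : y = y' := h.inf_o.symm.trans h'.inf_o
    rcases Side.eq_or_eq_opp s s' with rfl | rfl
    · rfl
    · exact absurd le_rfl (h.not_le_opp h')

end Fork

theorem forkLE_z_of_reflTransGen {s : Side} {p q : L × L} (hp : S.Leg s p.1 p.2)
    (h : Relation.ReflTransGen (S.LegStep s) p q) :
    ∃ hq : S.Leg s q.1 q.2, S.ForkLE (Fork.z s q.1 q.2 hq) (Fork.z s p.1 p.2 hp) := by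
  induction h with
  | refl => exact ⟨hp, .refl⟩
  | tail _ h ih => exact ⟨Leg.step h.1 h.2, .head (ForkStep.z_z s h.1 h.2) ih.2⟩

theorem forkLE_z_t {s : Side} {x y : L} (h : S.Leg s x y) : S.ForkLE (Fork.z s x y h) Fork.t := by
  obtain ⟨h', h1⟩ := forkLE_z_of_reflTransGen Leg.base h.reflTransGen
  exact h1.tail (ForkStep.z_t s)

theorem shadow_le_of_forkLE {p q : S.Fork} (h : S.ForkLE p q) :
    p.shadow ≤ q.shadow ∧ (p.IsHigh → q.IsHigh) := by
  induction h with
  | refl => exact ⟨le_rfl, id⟩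
  | tail _ h ih =>
    refine ⟨ih.1.trans ?_, fun hp => ?_⟩
    · cases h with
      | old h => exact h
      | t_i => exact le_rfl
      | z_t s => exact (Leg.base (s := s)).lt_i.le
      | y_z s h => exact h.covBy.le
      | z_x s h => exact le_rfl
      | z_z s h hsq => exact hsq.2.2.2.1.le
    · have := ih.2 hp
      cases h with
      | old h => exact fun hb => this (h.trans hb)
      | t_i => exact this.elim
      | z_t s => exact this.elim
      | y_z s h => exact absurd h.le_o this
      | z_x s h => exact this.elim
      | z_z s h hsq => exact this.elim

end CoveringSquare

/-! ### Coordinates on the fork and its lattice structure -/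

namespace IsOrientedSPS

open CoveringSquare

variable {L : Type*} [Lattice L] {lam : L → L → Prop} {S : CoveringSquare L}

theorem forkLE_iff (h : IsOrientedSPS lam) {p q : S.Fork} :
    S.ForkLE p q ↔ p.shadow ≤ q.shadow ∧ (p.IsHigh → q.IsHigh) := by
  refine ⟨shadow_le_of_forkLE, fun ⟨h1, h2⟩ => ?_⟩
  rcases p with a | _ | ⟨s, x, y, hl⟩ <;> rcases q with b | _ | ⟨s', x', y', hl'⟩ <;>
    simp only [Fork.shadow_old, Fork.shadow_t, Fork.shadow_z, Fork.isHigh_old, Fork.isHigh_t,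
      Fork.isHigh_z, imp_false, not_not] at h1 h2
  · exact .single (.old h1)
  · exact .head (.old h2) (.head (.y_z Side.left Leg.base) (.single (.z_t Side.left)))
  · exact .head (.old (hl'.inf_o ▸ le_inf h1 h2)) (.single (.y_z s' hl'))
  · exact .head .t_i (.single (.old h1))
  · exact .refl
  · exact absurd h1 hl'.lt_i.not_ge
  · exact .head (.z_x s hl) (.single (.old h1))
  · exact forkLE_z_t hl
  · rcases Side.eq_or_eq_opp s s' with rfl | rfl
    · exact (forkLE_z_of_reflTransGen hl' (h.reflTransGen_of_le hl' hl h1)).2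
    · exact absurd h1 (hl.not_le_opp hl')

theorem exists_fork_sup (h : IsOrientedSPS lam) (p q : S.Fork) :
    ∃ r : S.Fork, r.shadow = p.shadow ⊔ q.shadow ∧ (r.IsHigh ↔ p.IsHigh ∨ q.IsHigh) := by
  by_cases hpq : p.IsHigh ∨ q.IsHigh
  · refine ⟨Fork.old (p.shadow ⊔ q.shadow), rfl, iff_of_true (fun hle => ?_) hpq⟩
    rcases hpq with hp | hq
    · exact hp.not_le (le_sup_left.trans hle)
    · exact hq.not_le (le_sup_right.trans hle)
  · obtain ⟨r, hr, hr'⟩ := Fork.exists_of_mem_lowSet (h.sup_mem_lowSet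
      (Fork.shadow_mem_lowSet fun hp => hpq (Or.inl hp))
      (Fork.shadow_mem_lowSet fun hq => hpq (Or.inr hq)))
    exact ⟨r, hr, iff_of_false hr' hpq⟩

/-- If both factors are high, the coordinatewise meet is the shadow of an old element. Otherwise the
meet must be low, and its shadow is the approximation in `lowSet`. The last conjunct records that
the resulting error in the shadow is invisible to `lowCon`. -/
theorem exists_fork_inf (h : IsOrientedSPS lam) (hS : S.IsTight) (p q : S.Fork) :
    ∃ r : S.Fork, (r.shadow ≤ p.shadow ⊓ q.shadow ∧ (r.IsHigh → p.IsHigh ∧ q.IsHigh)) ∧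
      (∀ c : S.Fork, c.shadow ≤ p.shadow ⊓ q.shadow → (c.IsHigh → p.IsHigh ∧ q.IsHigh) →
        c.shadow ≤ r.shadow ∧ (c.IsHigh → r.IsHigh)) ∧
      LowEquiv S.i r.shadow (p.shadow ⊓ q.shadow) := by
  by_cases hpq : p.IsHigh ∧ q.IsHigh
  · exact ⟨Fork.old (p.shadow ⊓ q.shadow), ⟨le_rfl, fun _ => hpq⟩,
      fun c hc _ => ⟨hc, fun hc' hle => hc'.not_le (hc.trans hle)⟩, fun _ _ => Iff.rfl⟩
  · have key : ∃ g ∈ S.lowSet, g ≤ p.shadow ⊓ q.shadow ∧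
        (∀ g' ∈ S.lowSet, g' ≤ p.shadow ⊓ q.shadow → g' ≤ g) ∧
        LowEquiv S.i g (p.shadow ⊓ q.shadow) := by
      rcases not_and_or.mp hpq with hp | hq
      · exact h.exists_approx hS (Fork.shadow_mem_lowSet hp) inf_le_left
      · exact h.exists_approx hS (Fork.shadow_mem_lowSet hq) inf_le_right
    obtain ⟨g, hg, h1, h2, h3⟩ := key
    obtain ⟨r, rfl, hr⟩ := Fork.exists_of_mem_lowSet hg
    exact ⟨r, ⟨h1, fun hr' => absurd hr' hr⟩, fun c hc hc' =>
      ⟨h2 _ (Fork.shadow_mem_lowSet fun hh => hpq (hc' hh)) hc, fun hh => absurd (hc' hh) hpq⟩, h3⟩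

/-- The lattice `L[S]`. -/
noncomputable abbrev forkLattice (h : IsOrientedSPS lam) (hS : S.IsTight) : Lattice S.Fork where
  le p q := p.shadow ≤ q.shadow ∧ (p.IsHigh → q.IsHigh)
  le_refl p := ⟨le_rfl, id⟩
  le_trans p q r h1 h2 := ⟨h1.1.trans h2.1, h2.2 ∘ h1.2⟩
  le_antisymm p q h1 h2 := Fork.ext_shadow (le_antisymm h1.1 h2.1) ⟨h1.2, h2.2⟩
  sup p q := (h.exists_fork_sup p q).choose
  le_sup_left p q := by
    obtain ⟨h1, h2⟩ := (h.exists_fork_sup p q).choose_spec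
    exact ⟨le_sup_left.trans h1.ge, fun hp => h2.mpr (Or.inl hp)⟩
  le_sup_right p q := by
    obtain ⟨h1, h2⟩ := (h.exists_fork_sup p q).choose_spec
    exact ⟨le_sup_right.trans h1.ge, fun hp => h2.mpr (Or.inr hp)⟩
  sup_le p q r hp hq := by
    obtain ⟨h1, h2⟩ := (h.exists_fork_sup p q).choose_spec
    exact ⟨h1.le.trans <| sup_le hp.1 hq.1, fun h3 => (h2.mp h3).elim hp.2 hq.2⟩
  inf p q := (h.exists_fork_inf hS p q).choose
  inf_le_left p q := by
    obtain ⟨⟨h1, h2⟩, -, -⟩ := (h.exists_fork_inf hS p q).choose_spec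
    exact ⟨h1.trans inf_le_left, fun h3 => (h2 h3).1⟩
  inf_le_right p q := by
    obtain ⟨⟨h1, h2⟩, -, -⟩ := (h.exists_fork_inf hS p q).choose_spec
    exact ⟨h1.trans inf_le_right, fun h3 => (h2 h3).2⟩
  le_inf p q r hq hr := by
    obtain ⟨-, h2, -⟩ := (h.exists_fork_inf hS q r).choose_spec
    exact h2 p (le_inf hq.1 hr.1) fun hp => ⟨hq.2 hp, hr.2 hp⟩

end IsOrientedSPS

/-- The order of the lattice `L[S]` is the induced order of a product of `L` with a chain. -/
def CoveringSquare.HasForkOrder {L : Type*} [Lattice L] (S : CoveringSquare L)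
    [LE S.Fork] : Prop :=
  ∀ p q : S.Fork, p ≤ q ↔ p.shadow ≤ q.shadow ∧ (p.IsHigh → q.IsHigh)

/-! ### Lattice operations in coordinates and two congruences of the fork -/

namespace CoveringSquare.HasForkOrder

variable {L : Type*} [Lattice L] {S : CoveringSquare L} [Lattice S.Fork]

theorem sup_eq (hF : S.HasForkOrder) {p q r : S.Fork} (h1 : r.shadow = p.shadow ⊔ q.shadow)
    (h2 : r.IsHigh ↔ p.IsHigh ∨ q.IsHigh) : p ⊔ q = r := by
  refine le_antisymm (sup_le ((hF _ _).mpr ⟨h1 ▸ le_sup_left, fun hp => h2.mpr (Or.inl hp)⟩)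
    ((hF _ _).mpr ⟨h1 ▸ le_sup_right, fun hp => h2.mpr (Or.inr hp)⟩)) ((hF _ _).mpr ⟨?_, fun h3 => ?_⟩)
  · rw [h1]
    exact sup_le ((hF _ _).mp le_sup_left).1 ((hF _ _).mp le_sup_right).1
  · exact (h2.mp h3).elim ((hF _ _).mp le_sup_left).2 ((hF _ _).mp le_sup_right).2

theorem inf_eq (hF : S.HasForkOrder) {p q r : S.Fork} (h1 : r ≤ p) (h2 : r ≤ q)
    (h3 : ∀ c : S.Fork, c.shadow ≤ p.shadow ⊓ q.shadow → (c.IsHigh → p.IsHigh ∧ q.IsHigh) →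
        c.shadow ≤ r.shadow ∧ (c.IsHigh → r.IsHigh)) : p ⊓ q = r := by
  refine le_antisymm ((hF _ _).mpr (h3 _ (le_inf ((hF _ _).mp inf_le_left).1
    ((hF _ _).mp inf_le_right).1) fun h4 => ⟨((hF _ _).mp inf_le_left).2 h4,
      ((hF _ _).mp inf_le_right).2 h4⟩)) (le_inf h1 h2)

theorem old_le_old (hF : S.HasForkOrder) {a b : L} :
    (Fork.old a : S.Fork) ≤ Fork.old b ↔ a ≤ b :=
  (hF _ _).trans ⟨And.left, fun h => ⟨h, fun ha hb => ha (h.trans hb)⟩⟩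

theorem old_lt_old (hF : S.HasForkOrder) {a b : L} :
    (Fork.old a : S.Fork) < Fork.old b ↔ a < b := by
  rw [lt_iff_le_not_ge, lt_iff_le_not_ge, hF.old_le_old, hF.old_le_old]

theorem old_sup_old (hF : S.HasForkOrder) (a b : L) :
    (Fork.old a : S.Fork) ⊔ Fork.old b = Fork.old (a ⊔ b) :=
  hF.sup_eq rfl (by simp only [Fork.isHigh_old, sup_le_iff]; tauto)

theorem old_inf_old (hF : S.HasForkOrder) (a b : L) :
    (Fork.old a : S.Fork) ⊓ Fork.old b = Fork.old (a ⊓ b) :=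
  hF.inf_eq (hF.old_le_old.mpr inf_le_left) (hF.old_le_old.mpr inf_le_right)
    fun _ hc _ => ⟨hc, fun hc' hle => hc'.not_le (hc.trans hle)⟩

variable {lam : L → L → Prop}

theorem shadow_sup (hF : S.HasForkOrder) (h : IsOrientedSPS lam) (p q : S.Fork) :
    (p ⊔ q).shadow = p.shadow ⊔ q.shadow := by
  obtain ⟨r, h1, h2⟩ := h.exists_fork_sup p q
  rw [hF.sup_eq h1 h2, h1]

theorem isHigh_sup (hF : S.HasForkOrder) (h : IsOrientedSPS lam) (p q : S.Fork) :
    (p ⊔ q).IsHigh ↔ p.IsHigh ∨ q.IsHigh := by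
  obtain ⟨r, h1, h2⟩ := h.exists_fork_sup p q
  rw [hF.sup_eq h1 h2, h2]

theorem isHigh_inf (hF : S.HasForkOrder) (p q : S.Fork) :
    (p ⊓ q).IsHigh ↔ p.IsHigh ∧ q.IsHigh ∧ ¬ p.shadow ⊓ q.shadow ≤ S.o := by
  constructor
  · intro h
    refine ⟨((hF _ _).mp inf_le_left).2 h, ((hF _ _).mp inf_le_right).2 h, fun hle => ?_⟩
    exact h.not_le ((le_inf ((hF _ _).mp inf_le_left).1 ((hF _ _).mp inf_le_right).1).trans hle)
  · rintro ⟨hp, hq, h⟩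
    rw [hp.eq_old, hq.eq_old, hF.old_inf_old]
    exact h

theorem lowEquiv_shadow_inf (hF : S.HasForkOrder) (h : IsOrientedSPS lam) (hS : S.IsTight)
    (p q : S.Fork) : LowEquiv S.i (p ⊓ q).shadow (p.shadow ⊓ q.shadow) := by
  obtain ⟨r, ⟨h1, h2⟩, h3, h4⟩ := h.exists_fork_inf hS p q
  rwa [hF.inf_eq ((hF _ _).mpr ⟨h1.trans inf_le_left, fun h5 => (h2 h5).1⟩)
    ((hF _ _).mpr ⟨h1.trans inf_le_right, fun h5 => (h2 h5).2⟩) h3]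

/-- The congruence of `L[S]` induced by `lowCon` along `Fork.shadow`. -/
def shadowCon (hF : S.HasForkOrder) (h : IsOrientedSPS lam) (hS : S.IsTight) :
    LatticeCon S.Fork where
  r p q := LowEquiv S.i p.shadow q.shadow
  iseqv := ⟨fun _ _ _ => Iff.rfl, LowEquiv.symm, LowEquiv.trans⟩
  inf {w x y z} h1 h2 := ((hF.lowEquiv_shadow_inf h hS w y).trans
    ((h.lowCon S.i).inf h1 h2)).trans (hF.lowEquiv_shadow_inf h hS x z).symm
  sup {w x y z} h1 h2 := by
    rw [hF.shadow_sup h, hF.shadow_sup h]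
    exact (h.lowCon S.i).sup h1 h2

/-- The restriction of `shadowCon` that does not identify elements below `t` with elements not
below `t`. -/
def levelCon (hF : S.HasForkOrder) (h : IsOrientedSPS lam) (hS : S.IsTight) :
    LatticeCon S.Fork where
  r p q := (hF.shadowCon h hS).r p q ∧ (p.IsHigh ↔ q.IsHigh)
  iseqv := ⟨fun p => ⟨(hF.shadowCon h hS).refl p, Iff.rfl⟩,
    fun h1 => ⟨(hF.shadowCon h hS).symm h1.1, h1.2.symm⟩,
    fun h1 h2 => ⟨(hF.shadowCon h hS).trans h1.1 h2.1, h1.2.trans h2.2⟩⟩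
  inf {w x y z} h1 h2 := by
    refine ⟨(hF.shadowCon h hS).inf h1.1 h2.1, ?_⟩
    have h3 : LowEquiv S.i (w.shadow ⊓ y.shadow) (x.shadow ⊓ z.shadow) :=
      (h.lowCon S.i).inf h1.1 h2.1
    rw [hF.isHigh_inf, hF.isHigh_inf, h1.2, h2.2]
    have h4 : w.shadow ⊓ y.shadow ≤ S.o ↔ x.shadow ⊓ z.shadow ≤ S.o :=
      ⟨h.le_o_of_lowEquiv h3, h.le_o_of_lowEquiv h3.symm⟩
    rw [h4]
  sup h1 h2 := ⟨(hF.shadowCon h hS).sup h1.1 h2.1, by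
    rw [hF.isHigh_sup h, hF.isHigh_sup h, h1.2, h2.2]⟩

end CoveringSquare.HasForkOrder

/-! ## Join-irreducible congruences -/

namespace LatticeCon

variable {K : Type*} [Lattice K]

theorem gen_le {R : K → K → Prop} {c : LatticeCon K} (h : ∀ a b, R a b → c.r a b) : gen R ≤ c :=
  sInf_le h

theorem gen_of {R : K → K → Prop} {a b : K} (h : R a b) : (gen R).r a b := by
  rintro _ ⟨c, hc, rfl⟩
  exact hc a b h

theorem principal_rel (a b : K) : (principal a b).r a b := gen_of ⟨rfl, rfl⟩

theorem principal_le {a b : K} {c : LatticeCon K} (h : c.r a b) : principal a b ≤ c :=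
  gen_le (by rintro _ _ ⟨rfl, rfl⟩; exact h)

theorem principal_eq_of_rel {a b c d : K} (h : (principal a b).r c d) (h' : (principal c d).r a b) :
    principal a b = principal c d :=
  le_antisymm (principal_le h') (principal_le h)

theorem sup_left (c : LatticeCon K) {a b : K} (h : c.r a b) (x : K) : c.r (a ⊔ x) (b ⊔ x) :=
  c.sup h (c.refl x)

theorem inf_left (c : LatticeCon K) {a b : K} (h : c.r a b) (x : K) : c.r (a ⊓ x) (b ⊓ x) :=
  c.inf h (c.refl x)

theorem rel_of_mem_Icc (c : LatticeCon K) {a b x y : K} (h : c.r a b) (hax : a ≤ x) (hxy : x ≤ y)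
    (hyb : y ≤ b) : c.r x y := by
  have h1 := c.inf_left (c.sup_left h x) y
  rwa [sup_eq_right.mpr hax, sup_eq_left.mpr (hxy.trans hyb), inf_eq_left.mpr hxy,
    inf_eq_right.mpr hyb] at h1

/-- The equality relation. -/
def eqCon (K : Type*) [Lattice K] : LatticeCon K where
  r := Eq
  iseqv := eq_equivalence
  inf h h' := by rw [h, h']
  sup h h' := by rw [h, h']

/-- The join of two congruences, as the transitive closure of their union. -/
def joinCon (c d : LatticeCon K) : LatticeCon K where
  r := Relation.EqvGen fun x y => c.r x y ∨ d.r x y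
  iseqv := Relation.EqvGen.is_equivalence _
  inf {w x y z} h h' := by
    have key : ∀ {a b : K}, Relation.EqvGen (fun x y => c.r x y ∨ d.r x y) a b → ∀ u,
        Relation.EqvGen (fun x y => c.r x y ∨ d.r x y) (a ⊓ u) (b ⊓ u) := by
      intro a b hab u
      induction hab with
      | rel a b hab => exact .rel _ _ (hab.imp (c.inf_left · u) (d.inf_left · u))
      | refl a => exact .refl _
      | symm a b _ ih => exact .symm _ _ ih
      | trans a b e _ _ ih ih' => exact .trans _ _ _ ih ih'
    refine .trans _ _ _ (key h y) ?_
    rw [inf_comm x, inf_comm x]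
    exact key h' x
  sup {w x y z} h h' := by
    have key : ∀ {a b : K}, Relation.EqvGen (fun x y => c.r x y ∨ d.r x y) a b → ∀ u,
        Relation.EqvGen (fun x y => c.r x y ∨ d.r x y) (a ⊔ u) (b ⊔ u) := by
      intro a b hab u
      induction hab with
      | rel a b hab => exact .rel _ _ (hab.imp (c.sup_left · u) (d.sup_left · u))
      | refl a => exact .refl _
      | symm a b _ ih => exact .symm _ _ ih
      | trans a b e _ _ ih ih' => exact .trans _ _ _ ih ih'
    refine .trans _ _ _ (key h y) ?_
    rw [sup_comm x, sup_comm x]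
    exact key h' x

/-- A prime interval collapsed by a join of two congruences is collapsed by one of them. -/
theorem rel_or_rel_of_sup {p q : K} (hpq : p ⋖ q) {c d : LatticeCon K} (h : (c ⊔ d).r p q) :
    c.r p q ∨ d.r p q := by
  have hle : c ⊔ d ≤ joinCon c d :=
    sup_le (fun _ _ hxy => .rel _ _ (Or.inl hxy)) (fun _ _ hxy => .rel _ _ (Or.inr hxy))
  have h1 : Relation.EqvGen (fun x y => c.r x y ∨ d.r x y) p q := hle h
  by_contra! hne
  have hf : ∀ x : K, (x ⊔ p) ⊓ q = p ∨ (x ⊔ p) ⊓ q = q := fun x =>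
    hpq.eq_or_eq (le_inf le_sup_right hpq.le) inf_le_right
  -- The map `x ↦ (x ⊔ p) ⊓ q` takes only the values `p` and `q`, so it is constant on the classes
  -- of any congruence that does not collapse `[p, q]`, and hence on the classes of the join.
  have key : ∀ e : LatticeCon K, ¬ e.r p q → ∀ x y, e.r x y → (x ⊔ p) ⊓ q = (y ⊔ p) ⊓ q := by
    intro e he x y hxy
    have h2 := e.inf_left (e.sup_left hxy p) q
    rcases hf x with hx | hx <;> rcases hf y with hy | hy <;> rw [hx, hy] at h2 ⊢
    · exact absurd h2 he
    · exact absurd (e.symm h2) he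
  have key' : ∀ x y, Relation.EqvGen (fun x y => c.r x y ∨ d.r x y) x y →
      (x ⊔ p) ⊓ q = (y ⊔ p) ⊓ q := by
    intro x y hxy
    induction hxy with
    | rel x y hxy => exact hxy.elim (key c hne.1 x y) (key d hne.2 x y)
    | refl x => rfl
    | symm x y _ ih => exact ih.symm
    | trans x y z _ _ ih ih' => exact ih.trans ih'
  have h3 := key' p q h1
  rw [sup_idem, inf_eq_left.mpr hpq.le, sup_eq_left.mpr hpq.le, inf_idem] at h3
  exact hpq.ne h3

/-- The congruence generated by a prime interval is join-irreducible. -/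
theorem supIrred_principal {p q : K} (hpq : p ⋖ q) : SupIrred (principal p q) := by
  refine ⟨fun hmin => ?_, fun c d hcd => ?_⟩
  · have h1 : principal p q ≤ eqCon K :=
      (hmin bot_le).trans bot_le
    exact hpq.ne (h1 (principal_rel p q))
  · have h1 := principal_rel p q
    rw [← hcd] at h1
    exact (rel_or_rel_of_sup hpq h1).imp
      (fun h2 => le_antisymm (hcd ▸ le_sup_left) (principal_le h2))
      (fun h2 => le_antisymm (hcd ▸ le_sup_right) (principal_le h2))

/-- In a finite lattice, a congruence that collapses the prime intervals collapsed by `c`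
contains `c`. -/
theorem le_of_covBy_rel [Finite K] {c d : LatticeCon K} (h : ∀ p q, p ⋖ q → c.r p q → d.r p q) :
    c ≤ d := by
  have key : ∀ u v : K, u ≤ v → c.r u v → d.r u v := by
    intro u
    induction u using WellFoundedGT.induction with
    | ind u ih =>
    intro v huv hc
    rcases huv.eq_or_lt with rfl | huv
    · exact d.refl u
    · obtain ⟨w, huw, hwv⟩ := exists_covBy_le_of_lt huv
      exact d.trans (h u w huw (c.rel_of_mem_Icc hc le_rfl huw.le hwv))
        (ih w huw.lt v hwv (c.rel_of_mem_Icc hc huw.le hwv le_rfl))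
  intro x y hxy
  exact d.r_inf_sup_iff.mp (key _ _ inf_le_sup (c.r_inf_sup_iff.mpr hxy))

/-- A join-irreducible congruence of a finite lattice is generated by a prime interval. -/
theorem exists_eq_principal_of_supIrred [Finite K] {c : LatticeCon K} (hc : SupIrred c) :
    ∃ p q : K, p ⋖ q ∧ c = principal p q := by
  classical
  have := Fintype.ofFinite K
  let A : Finset (K × K) := Finset.univ.filter fun e => e.1 ⋖ e.2 ∧ c.r e.1 e.2
  have hA : A.sup (fun e => principal e.1 e.2) = c := by
    refine le_antisymm (Finset.sup_le fun e he => ?_) (le_of_covBy_rel fun p q hpq h => ?_)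
    · exact principal_le (Finset.mem_filter.mp he).2.2
    · have hmem : (p, q) ∈ A := Finset.mem_filter.mpr ⟨Finset.mem_univ _, hpq, h⟩
      have hle : principal p q ≤ A.sup (fun e => principal e.1 e.2) :=
        Finset.le_sup (f := fun e : K × K => principal e.1 e.2) hmem
      exact hle (principal_rel p q)
  obtain ⟨e, he, h⟩ := hc.finset_sup_eq hA
  exact ⟨e.1, e.2, (Finset.mem_filter.mp he).2.1, h.symm⟩

end LatticeCon

theorem CoveringSquare.Fork.finite {L : Type*} [Lattice L] [Finite L] {S : CoveringSquare L} :
    Finite S.Fork :=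
  Finite.of_injective (fun p : S.Fork => (p.shadow, p.IsHigh)) fun _ _ hpq =>
    Fork.ext_shadow (congrArg Prod.fst hpq) (iff_of_eq (congrArg Prod.snd hpq))

/-! ## The join-irreducible congruences of the fork extension -/

namespace CoveringSquare.HasForkOrder

open LatticeCon

variable {L : Type*} [Lattice L] {S : CoveringSquare L} [Lattice S.Fork] {lam : L → L → Prop}

/-- The restriction of a congruence of `L[S]` to `L`. -/
def restrictCon (hF : S.HasForkOrder) (c : LatticeCon S.Fork) : LatticeCon L where
  r a b := c.r (Fork.old a) (Fork.old b)
  iseqv := ⟨fun _ => c.refl _, fun h => c.symm h, fun h h' => c.trans h h'⟩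
  inf h h' := by rw [← hF.old_inf_old, ← hF.old_inf_old]; exact c.inf h h'
  sup h h' := by rw [← hF.old_sup_old, ← hF.old_sup_old]; exact c.sup h h'

theorem minimalExtension_principal (hF : S.HasForkOrder) (a b : L) :
    S.minimalExtension (principal a b) = principal (Fork.old a) (Fork.old b) := by
  refine le_antisymm (gen_le ?_) (principal_le (gen_of ⟨a, b, principal_rel a b, rfl, rfl⟩))
  rintro _ _ ⟨x, y, hxy, rfl, rfl⟩
  have h : principal a b ≤ hF.restrictCon (principal (Fork.old a) (Fork.old b)) :=
    principal_le (principal_rel _ _)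
  exact h hxy

/-- `shadowCon` contains `γ(S)`, since `t` and `i` have the same shadow. On pairs of old elements it
already respects being below `o`, so an extension from `L` contained in it is contained in
`levelCon`, which separates `t` from `i`. -/
theorem gamma_ne_minimalExtension (hF : S.HasForkOrder) (h : IsOrientedSPS lam) (hS : S.IsTight)
    (α : LatticeCon L) : S.gamma ≠ S.minimalExtension α := by
  intro he
  have h1 : S.gamma ≤ hF.shadowCon h hS := principal_le fun _ _ => Iff.rfl
  have h2 : S.minimalExtension α ≤ hF.levelCon h hS := by
    refine gen_le ?_
    rintro _ _ ⟨a, b, hab, rfl, rfl⟩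
    have h3 : (S.minimalExtension α).r (Fork.old a) (Fork.old b) := gen_of ⟨a, b, hab, rfl, rfl⟩
    rw [← he] at h3
    have h4 : LowEquiv S.i a b := h1 h3
    exact ⟨h4, not_congr ⟨h.le_o_of_lowEquiv h4, h.le_o_of_lowEquiv h4.symm⟩⟩
  rw [← he] at h2
  have h5 : (hF.levelCon h hS).r Fork.t (Fork.old S.i) := h2 (principal_rel _ _)
  exact h5.2.mpr S.o_lt_i.not_ge

theorem t_covBy_i (hF : S.HasForkOrder) : (Fork.t : S.Fork) ⋖ Fork.old S.i := by
  refine ⟨lt_iff_le_not_ge.mpr ⟨(hF _ _).mpr ⟨le_rfl, False.elim⟩, fun hle =>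
    ((hF _ _).mp hle).2 S.o_lt_i.not_ge⟩, fun c hc1 hc2 => ?_⟩
  obtain ⟨h1, h2⟩ := (hF _ _).mp hc1.le
  obtain ⟨h3, h4⟩ := (hF _ _).mp hc2.le
  by_cases hc : c.IsHigh
  · exact hc2.not_ge ((hF _ _).mpr ⟨h1, fun _ => hc⟩)
  · exact hc1.not_ge ((hF _ _).mpr ⟨h3, fun h => absurd h hc⟩)

theorem covBy_of_old_covBy (hF : S.HasForkOrder) {a b : L}
    (hab : (Fork.old a : S.Fork) ⋖ Fork.old b) : a ⋖ b :=
  ⟨hF.old_lt_old.mp hab.lt, fun _ h1 h2 => hab.2 (hF.old_lt_old.mpr h1) (hF.old_lt_old.mpr h2)⟩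

theorem z_sup_old (hF : S.HasForkOrder) {s : Side} {x y a : L} (hl : S.Leg s x y)
    (ha : ¬ a ≤ S.o) : Fork.z s x y hl ⊔ Fork.old a = Fork.old (x ⊔ a) :=
  hF.sup_eq rfl (iff_of_true (fun hle => ha (le_sup_right.trans hle)) (Or.inr ha))

theorem low_inf_old (hF : S.HasForkOrder) {p q : S.Fork} (hp : ¬ p.IsHigh) (hq : ¬ q.IsHigh)
    (hpq : p.shadow ≤ q.shadow) : Fork.old p.shadow ⊓ q = p := by
  refine hF.inf_eq ((hF _ _).mpr ⟨le_rfl, fun h => absurd h hp⟩)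
    ((hF _ _).mpr ⟨hpq, fun h => absurd h hp⟩) fun c hc hc' => ⟨hc.trans inf_le_left, fun h => ?_⟩
  exact absurd (hc' h).2 hq

/-- The prime interval `[y, z]` of a fork generates the same congruence as the interval `[y, x]`. -/
theorem principal_y_z (hF : S.HasForkOrder) (h : IsOrientedSPS lam) {s : Side} {x y : L}
    (hl : S.Leg s x y) :
    principal (Fork.old y) (Fork.z s x y hl) = principal (Fork.old y) (Fork.old x) := by
  refine principal_eq_of_rel ?_ ?_
  -- Joining with the opposite side carries `[y, z]` to the interval from that side to `i`; meeting
  -- with `x` then carries this to `[y, x]`.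
  · have h1 := (principal (Fork.old y) (Fork.z s x y hl)).sup_left (principal_rel _ _)
      (Fork.old (S.side s.opp))
    have h2 : y ≤ S.side s.opp := hl.le_o.trans (S.isCoveringSquare_side s).2.2.1.le
    rw [hF.old_sup_old, hF.z_sup_old hl (Leg.base (s := s.opp)).not_le_o, sup_eq_right.mpr h2,
      h.leg_sup_opp hl Leg.base] at h1
    have h3 := (principal (Fork.old y) (Fork.z s x y hl)).inf_left h1 (Fork.old x)
    have h4 : S.side s.opp ⊓ x = y := by
      refine le_antisymm ?_ (le_inf h2 hl.covBy.le)
      rw [← hl.inf_o, ← S.side_inf_side s]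
      exact le_inf inf_le_right (le_inf (inf_le_right.trans hl.le_side) inf_le_left)
    rwa [hF.old_inf_old, hF.old_inf_old, h4, inf_eq_right.mpr hl.lt_i.le] at h3
  · exact (principal (Fork.old y) (Fork.old x)).rel_of_mem_Icc (principal_rel _ _) le_rfl
      ((hF _ _).mpr ⟨hl.covBy.le, fun h => absurd hl.le_o h⟩) ((hF _ _).mpr ⟨le_rfl, False.elim⟩)

/-- The intervals `[z, x]` and `[t, i]` are perspective: `x ⊔ t = i` and `x ⊓ t = z`. -/
theorem principal_z_x (hF : S.HasForkOrder) {s : Side} {x y : L} (hl : S.Leg s x y) :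
    principal (Fork.z s x y hl) (Fork.old x) = S.gamma := by
  refine principal_eq_of_rel ?_ ?_
  · have h1 := (principal (Fork.z s x y hl) (Fork.old x)).sup_left (principal_rel _ _) Fork.t
    rwa [sup_eq_right.mpr ((hF (Fork.z s x y hl) Fork.t).mpr ⟨hl.lt_i.le, False.elim⟩),
      hF.sup_eq (p := Fork.old x) (q := Fork.t) (r := Fork.old S.i) (sup_eq_right.mpr hl.lt_i.le).symm
        (iff_of_true S.o_lt_i.not_ge (Or.inl hl.not_le_o))] at h1
  · have h1 := (principal (Fork.t : S.Fork) (Fork.old S.i)).inf_left (principal_rel _ _)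
      (Fork.old x)
    have h2 : Fork.old x ⊓ Fork.t = Fork.z s x y hl :=
      hF.low_inf_old (p := Fork.z s x y hl) (q := Fork.t) id id hl.lt_i.le
    rwa [inf_comm, h2, hF.old_inf_old,
      inf_eq_right.mpr hl.lt_i.le] at h1

/-- The interval `[z, q]` between low elements is perspective to the interval between their shadows:
joining with `x` goes up, meeting with `q` comes back. -/
theorem principal_z_low (hF : S.HasForkOrder) {s : Side} {x y : L} (hl : S.Leg s x y)
    {q : S.Fork} (hq : ¬ q.IsHigh) (hxq : x ≤ q.shadow) :
    principal (Fork.z s x y hl) q = principal (Fork.old x) (Fork.old q.shadow) := by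
  refine principal_eq_of_rel ?_ ?_
  · have h1 := (principal (Fork.z s x y hl) q).sup_left (principal_rel _ _) (Fork.old x)
    rwa [hF.z_sup_old hl hl.not_le_o, sup_idem,
      hF.sup_eq (p := q) (q := Fork.old x) (r := Fork.old q.shadow) (sup_eq_left.mpr hxq).symm
        (iff_of_true (fun hle => hl.not_le_o (hxq.trans hle)) (Or.inr hl.not_le_o))] at h1
  · have h1 := (principal (Fork.old x) (Fork.old q.shadow)).inf_left (principal_rel _ _) q
    have h2 : Fork.old x ⊓ q = Fork.z s x y hl := hF.low_inf_old (p := Fork.z s x y hl) id hq hxq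
    rwa [h2, hF.low_inf_old hq hq le_rfl] at h1

/-- The next element of the leg after `x`, or `i`, is a cover of `x`. -/
theorem covBy_of_z_covBy (hF : S.HasForkOrder) (h : IsOrientedSPS lam) {s : Side} {x y : L}
    (hl : S.Leg s x y) {q : S.Fork} (hq : ¬ q.IsHigh) (hzq : Fork.z s x y hl ⋖ q) :
    x ⋖ q.shadow := by
  have hle : ∀ {p p' : S.Fork}, ¬ p.IsHigh → p.shadow ≤ p'.shadow → p ≤ p' :=
    fun hp hpp' => (hF _ _).mpr ⟨hpp', fun h => absurd h hp⟩
  have hxq : x ≤ q.shadow := ((hF _ _).mp hzq.le).1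
  have hlt : ¬ q.shadow ≤ x := fun h' => hzq.lt.not_ge (hle hq h')
  cases hl with
  | base =>
    have h1 := (S.isCoveringSquare_side s).2.2.2.1
    rcases h1.eq_or_eq hxq (le_i_of_mem_lowSet (Fork.shadow_mem_lowSet hq)) with h2 | h2
    · exact absurd h2.le hlt
    · rwa [h2]
  | @step x₀ y₀ _ _ hl₀ hsq =>
    have hl := Leg.step hl₀ hsq
    have h2 : Fork.z s x y hl < Fork.z s x₀ y₀ hl₀ :=
      lt_iff_le_not_ge.mpr ⟨hle id hsq.2.2.2.1.le, fun h' =>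
        hsq.2.2.2.1.lt.not_ge ((hF _ _).mp h').1⟩
    -- The shadow of `q` is in `lowSet` and strictly above `x`, so it is `i` or a higher element of
    -- the same leg; in both cases it is at least `x₀`, the predecessor of `x` on the leg.
    have h3 : Fork.z s x₀ y₀ hl₀ ≤ q := by
      refine hle id ?_
      rcases Fork.shadow_mem_lowSet hq with h4 | h4 | ⟨s', y', h4⟩
      · exact absurd (hxq.trans h4) hl.not_le_o
      · rw [Fork.shadow_z, h4]; exact hl₀.lt_i.le
      · rcases Side.eq_or_eq_opp s s' with rfl | rfl
        · by_contra h5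
          have h6 := (h.leg_total hl₀ h4).resolve_left h5
          have h7 : q.shadow < x₀ := lt_of_le_of_ne h6 fun e => h5 e.ge
          exact hlt (h.leg_le_of_lt hl₀ hsq h4 h7)
        · exact absurd hxq (hl.not_le_opp h4)
    rw [← (hzq.eq_or_eq h2.le h3).resolve_left h2.ne']
    exact hsq.2.2.2.1

/-- Every prime interval of `L[S]` generates either `γ(S)` or the minimal extension of the
congruence generated by a prime interval of `L`. -/
theorem principal_eq_gamma_or (hF : S.HasForkOrder) (h : IsOrientedSPS lam) {p q : S.Fork}
    (hpq : p ⋖ q) :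
    principal p q = S.gamma ∨
      ∃ a b : L, a ⋖ b ∧ principal p q = principal (Fork.old a) (Fork.old b) := by
  obtain ⟨hle, hhigh⟩ := (hF _ _).mp hpq.le
  cases p with
  | old a =>
    cases q with
    | old b => exact Or.inr ⟨a, b, hF.covBy_of_old_covBy hpq, rfl⟩
    | t =>
      have hao : a ≤ S.o := not_not.mp hhigh
      exfalso
      refine hpq.2 (c := Fork.z Side.left _ _ Leg.base)
        (lt_iff_le_not_ge.mpr ⟨(hF _ _).mpr ⟨?_, fun h => absurd hao h⟩, fun h => ?_⟩)
        (lt_iff_le_not_ge.mpr ⟨(hF _ _).mpr ⟨?_, id⟩, fun h => ?_⟩)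
      · exact hao.trans (Leg.base (s := Side.left)).covBy.le
      · exact (Leg.base (s := Side.left)).not_le_o (((hF _ _).mp h).1.trans hao)
      · exact (Leg.base (s := Side.left)).lt_i.le
      · exact (Leg.base (s := Side.left)).lt_i.not_ge ((hF _ _).mp h).1
    | z s x y hl =>
      have hay : a ≤ y := hl.inf_o ▸ le_inf hle (not_not.mp hhigh)
      obtain rfl : a = y := by
        by_contra hne
        refine hpq.2 (c := Fork.old y) (hF.old_lt_old.mpr (lt_of_le_of_ne hay hne))
          (lt_iff_le_not_ge.mpr ⟨(hF _ _).mpr ⟨hl.covBy.le, fun h => absurd hl.le_o h⟩, fun h => ?_⟩)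
        exact hl.covBy.lt.not_ge ((hF _ _).mp h).1
      exact Or.inr ⟨a, x, hl.covBy, hF.principal_y_z h hl⟩
  | t =>
    left
    cases q with
    | old b =>
      have h1 : (Fork.old S.i : S.Fork) ≤ Fork.old b := hF.old_le_old.mpr hle
      rw [← (hpq.eq_or_eq hF.t_covBy_i.le h1).resolve_left hF.t_covBy_i.ne']
      rfl
    | t => exact absurd rfl hpq.ne
    | z s x y hl => exact absurd hle hl.lt_i.not_ge
  | z s x y hl =>
    by_cases hq : q.IsHigh
    · left
      have h1 : Fork.z s x y hl < Fork.old x :=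
        lt_iff_le_not_ge.mpr ⟨(hF _ _).mpr ⟨le_rfl, False.elim⟩, fun h =>
          ((hF _ _).mp h).2 hl.not_le_o⟩
      have h2 : Fork.old x ≤ q := (hF _ _).mpr ⟨hle, fun _ => hq⟩
      rw [← (hpq.eq_or_eq h1.le h2).resolve_left h1.ne']
      exact hF.principal_z_x hl
    · exact Or.inr ⟨x, q.shadow, hF.covBy_of_z_covBy h hl hq hpq, hF.principal_z_low hl hq hle⟩

theorem new_supIrred_eq (hF : S.HasForkOrder) (h : IsOrientedSPS lam) (hS : S.IsTight) :
    {θ : LatticeCon S.Fork | SupIrred θ ∧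
        ¬ ∃ α : LatticeCon L, SupIrred α ∧ θ = S.minimalExtension α} = {S.gamma} := by
  have := h.finite
  have := Fork.finite (S := S)
  ext θ
  simp only [Set.mem_ofPred_eq, Set.mem_singleton_iff]
  constructor
  · rintro ⟨hθ, hne⟩
    obtain ⟨p, q, hpq, rfl⟩ := exists_eq_principal_of_supIrred hθ
    refine (hF.principal_eq_gamma_or h hpq).resolve_right ?_
    rintro ⟨a, b, hab, he⟩
    exact hne ⟨principal a b, supIrred_principal hab, by rw [he, hF.minimalExtension_principal]⟩
  · rintro rfl
    exact ⟨supIrred_principal hF.t_covBy_i, fun ⟨α, _, he⟩ => hF.gamma_ne_minimalExtension h hS α he⟩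

end CoveringSquare.HasForkOrder

theorem theorem3 {L : Type*} [Lattice L] (hL : IsSPS L) (S : CoveringSquare L) (hS : S.IsTight) :
    ∃ _ : Lattice S.Fork,
      (∀ p q : S.Fork, p ≤ q ↔ S.ForkLE p q) ∧
      (∀ a b : L, (CoveringSquare.Fork.old (a ⊔ b) : S.Fork) =
        CoveringSquare.Fork.old a ⊔ CoveringSquare.Fork.old b) ∧
      (∀ a b : L, (CoveringSquare.Fork.old (a ⊓ b) : S.Fork) =
        CoveringSquare.Fork.old a ⊓ CoveringSquare.Fork.old b) ∧
      {θ : LatticeCon S.Fork | SupIrred θ ∧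
        ¬ ∃ α : LatticeCon L, SupIrred α ∧ θ = S.minimalExtension α} = {S.gamma} := by
  have : Nonempty L := ⟨S.o⟩
  obtain ⟨lam, h⟩ := hL.exists_isOrientedSPS
  let := h.forkLattice hS
  have hF : S.HasForkOrder := fun _ _ => Iff.rfl
  exact ⟨h.forkLattice hS, fun p q => h.forkLE_iff.symm, fun a b => (hF.old_sup_old a b).symm,
    fun a b => (hF.old_inf_old a b).symm, hF.new_supIrred_eq h hS⟩
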